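/- Let $\mathcal H$ be a separable complex Hilbert space, with inner product $\langle\cdot,\cdot\rangle$ antilinear in its first argument. Let $A$ be a closed symmetric operator in $\mathcal H$, not necessarily densely defined. Its adjoint is the linear relation $$A^*=\{(\eta,\omega)\in\mathcal H\oplus\mathcal H:\langle\eta,A\varphi\rangle=\langle\omega,\varphi\rangle\ \text{for all }\varphi\in\operatorname{dom}A\}.$$ Assume that: * $A$ has deficiency indices $(1,1)$, that is, $\dim\ker(A^*-zI)=1$ for all $z\in\mathbb C\setminus\mathbb R$; * $A$ is simple, that is, $\bigcap_{z\in\mathbb C\setminus\mathbb R}\operatorname{ran}(A-zI)=\{0\}$; * $A$ is regular, that is, for every $z\in\mathbb C$ there is $d_z>0$ with $\|(A-zI)\varphi\|\ge d_z\|\varphi\|$ for all $\varphi\in\operatorname{dom}A$. Let $A_\gamma$ be a selfadjoint extension of $A$ within $\mathcal H$ (a selfadjoint linear relation $A_\gamma=A_\gamma^*\subset\mathcal H\oplus\mathcal H$ containing the graph of $A$). Its spectrum $\operatorname{Sp}(A_\gamma)$ is the complement of the set of $z\in\mathbb C$ for which $(A_\gamma-zI)^{-1}$ is a bounded operator defined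 on all of $\mathcal H$. Let $J$ be an involution on $\mathcal H$ (antilinear, $J^2=I$, $\langle J\varphi,J\eta\rangle=\langle\eta,\varphi\rangle$) that commutes with $A_\gamma$, that is, $J(A_\gamma-zI)^{-1}=(A_\gamma-\overline zI)^{-1}J$ for all $z\in\mathbb C\setminus\mathbb R$. Let $v\in\mathbb R\setminus\operatorname{Sp}(A_\gamma)$, let $0\neq\psi_v\in\ker(A^*-vI)$ with $J\psi_v=\psi_v$, and let $h_\gamma$ be a real entire function (i.e. $h_\gamma(\overline z)=\overline{h_\gamma(z)}$) whose zero set is $\operatorname{Sp}(A_\gamma)$. Put $$\xi(z)=h_\gamma(z)\left[\psi_v+(z-v)(A_\gamma-zI)^{-1}\psi_v\right],$$ extended by continuity to $\operatorname{Sp}(A_\gamma)$, and $$(\Phi\varphi)(z)=\langle\xi(\overline z),\varphi\rangle\quad(\varphi\in\mathcal H),\qquad \widehat{\mathcal H}=\Phi\mathcal H.$$ An element $\mu\in\mathcal H$ is called an entire gauge of $A$ if $\mathcal H=\operatorname{ran}(A-zI)\dotplus\operatorname{span}\{\mu\}$ for all $z\in\mathbb C$; it is called real if $J\mu=\mu$.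 Assume that the constant function $1$ belongs to $\widehat{\mathcal H}$. Then there exists $\mu\in\mathcal H$ with $J\mu=\mu$ such that $$h_\gamma(z)=\left\langle\mu,\ \psi_v+(z-v)(A_\gamma-zI)^{-1}\psi_v\right\rangle^{-1}\qquad\text{for all }z\in\mathbb C\setminus\operatorname{Sp}(A_\gamma).$$ Moreover, $\mu$ is the unique real entire gauge of $A$ modulo a real scalar factor: an element $\mu'\in\mathcal H$ is a real entire gauge of $A$ if and only if $\mu'=c\mu$ for some $c\in\mathbb R\setminus\{0\}$. Finally, $\Phi$ is Krein's functional model for the gauge $\mu$: for all $\varphi\in\mathcal H$ and $z\in\mathbb C$, $$\varphi-(\Phi\varphi)(z)\,\mu\in\operatorname{ran}(A-zI).$$ -/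

import Mathlib

open Filter Topology ComplexConjugate

noncomputable section

namespace EntireOperator

variable {H : Type*} [NormedAddCommGroup H] [InnerProductSpace ℂ H]

/-! ### Linear relations, i.e. subspaces of `H × H` -/

/-- The linear relation `B - z I = {(η, ω - z η) : (η, ω) ∈ B}`. -/
def shift (B : Submodule ℂ (H × H)) (z : ℂ) : Submodule ℂ (H × H) :=
  B.map ((LinearMap.fst ℂ H H).prod (LinearMap.snd ℂ H H - z • LinearMap.fst ℂ H H))

/-- The kernel `{η : (η, 0) ∈ B}` of a linear relation. -/
def ker (B : Submodule ℂ (H × H)) : Submodule ℂ H :=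
  B.comap (LinearMap.inl ℂ H H)

/-- The range `{ω : (η, ω) ∈ B for some η}` of a linear relation. -/
def ran (B : Submodule ℂ (H × H)) : Submodule ℂ H :=
  B.map (LinearMap.snd ℂ H H)

/-- The inverse relation `{(ω, η) : (η, ω) ∈ B}`. -/
def inv (B : Submodule ℂ (H × H)) : Submodule ℂ (H × H) :=
  B.map (LinearEquiv.prodComm ℂ H H : (H × H) →ₗ[ℂ] (H × H))

/-- `(B - z I)⁻¹` is (the graph of) the bounded everywhere defined operator `R`. -/
def IsResolvent (B : Submodule ℂ (H × H)) (z : ℂ) (R : H →L[ℂ] H) : Prop :=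
  inv (shift B z) = (R : H →ₗ[ℂ] H).graph

/-- The spectrum of `B`: the complement of the set of all `z` for which `(B - z I)⁻¹` is a bounded
operator defined on all of `H`. -/
def spec (B : Submodule ℂ (H × H)) : Set ℂ :=
  {z | ¬ ∃ R : H →L[ℂ] H, IsResolvent B z R}

open Classical in
/-- The resolvent operator `(B - z I)⁻¹` for `z` outside the spectrum
(and `0`, by convention, at points of the spectrum). -/
def resolventOp (B : Submodule ℂ (H × H)) (z : ℂ) : H →L[ℂ] H :=
  if h : ∃ R : H →L[ℂ] H, IsResolvent B z R then h.choose else 0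

/-- A linear relation is selfadjoint if it equals its adjoint
`B* = {(η, ω) : ⟪η, χ⟫ = ⟪ω, φ⟫ for all (φ, χ) ∈ B}`. -/
def IsSelfadjointRel (B : Submodule ℂ (H × H)) : Prop :=
  B = B.adjoint

/-! ### The class of operators -/

/-- Simple, regular, closed symmetric operators with deficiency indices `(1, 1)`; the domain is
not required to be dense, and the adjoint is a linear relation. -/
structure IsE1 (A : H →ₗ.[ℂ] H) : Prop where
  closed : A.IsClosed
  symmetric : ∀ x y : A.domain, inner ℂ (A x) (y : H) = inner ℂ (x : H) (A y)
  deficiency : ∀ z : ℂ, z.im ≠ 0 → Module.finrank ℂ (ker (shift A.graph.adjoint z)) = 1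
  simple : ⨅ (z : ℂ) (_ : z.im ≠ 0), ran (shift A.graph z) = ⊥
  regular : ∀ z : ℂ, ∃ d : ℝ, 0 < d ∧ ∀ x : A.domain, d * ‖(x : H)‖ ≤ ‖A x - z • (x : H)‖

/-- `B` is a selfadjoint extension of `A` within `H` (possibly a proper linear relation). -/
def IsSelfadjointExtension (A : H →ₗ.[ℂ] H) (B : Submodule ℂ (H × H)) : Prop :=
  IsSelfadjointRel B ∧ A.graph ≤ B

/-- `μ` is an entire gauge: `H = ran (A - z I) ∔ span {μ}` for every `z`. -/
def IsEntireGauge (A : H →ₗ.[ℂ] H) (μ : H) : Prop :=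
  ∀ z : ℂ, IsCompl (ran (shift A.graph z)) (Submodule.span ℂ {μ})

/-! ### Involutions -/

/-- An involution (conjugation) on `H`: an antilinear `J` with `J² = I` and
`⟪J x, J y⟫ = ⟪y, x⟫`. -/
structure IsInvolution (J : H →ₗ⋆[ℂ] H) : Prop where
  involutive : ∀ x, J (J x) = x
  inner_map : ∀ x y, inner ℂ (J x) (J y) = inner ℂ y x

/-- `J (B - z I)⁻¹ = (B - z̄ I)⁻¹ J` for all non-real `z`. -/
def Commutes (J : H →ₗ⋆[ℂ] H) (B : Submodule ℂ (H × H)) : Prop :=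
  ∀ z : ℂ, z.im ≠ 0 → ∀ x : H, J (resolventOp B z x) = resolventOp B (conj z) (J x)

/-! ### The functional model -/

/-- `[I + (z - v) (B - z I)⁻¹] ψ`. -/
def cayley (B : Submodule ℂ (H × H)) (v : ℂ) (ψ : H) (z : ℂ) : H :=
  ψ + (z - v) • resolventOp B z ψ

/-- `h` is a real entire function with zero set `spec B`. -/
structure IsRealEntireWithZeros (B : Submodule ℂ (H × H)) (h : ℂ → ℂ) : Prop where
  entire : Differentiable ℂ h
  real : ∀ z, h (conj z) = conj (h z)
  zeros : ∀ z, h z = 0 ↔ z ∈ spec B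

open Classical in
/-- The function `ξ(z) = h(z) [I + (z - v) (B - z I)⁻¹] ψ`, extended by its limits
to the (removable) singularities at the points of `spec B`. -/
def xi (B : Submodule ℂ (H × H)) (h : ℂ → ℂ) (v : ℂ) (ψ : H) (z : ℂ) : H :=
  if z ∈ spec B then limUnder (𝓝[≠] z) (fun w => h w • cayley B v ψ w)
  else h z • cayley B v ψ z

/-- The map `(Φ φ)(z) = ⟪ξ(z̄), φ⟫`. -/
def Phi (ξ : ℂ → H) : H →ₗ[ℂ] (ℂ → ℂ) :=
  LinearMap.pi fun z => (innerSL ℂ (ξ (conj z)) : H →ₗ[ℂ] ℂ)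

/-- The space of functions `Ĥ = Φ H`. -/
def modelSpace (ξ : ℂ → H) : Submodule ℂ (ℂ → ℂ) :=
  LinearMap.range (Phi ξ)

end EntireOperator

end

/-! Choose μ with Φμ = 1, so that ⟨ξ(z̄), μ⟩ = 1 for every z. Then ξ never vanishes, and regularity
makes each ran(A - zI) the orthogonal complement of the single vector ξ(z̄) (`IsE1.mem_ran_iff`), at
real z as well. The formula for h, the gauge property of μ and Krein's projection are read off from
this. Simplicity makes the ξ(z) with nonreal z total, which forces Jμ = μ.

Uniqueness is the hard part. For another real gauge μ', the function F(z) = ⟨μ', ξ(z)⟩ is entire,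
zero-free and real, and it has to be constant (`const_of_quotient_moderate_growth`). In the upper
half-plane the factor h cancels: F is the quotient of the matrix coefficients of `cayley` at μ' and
at μ, both zero-free and O((1 + |z|) / Im z). The logarithms of these coefficients therefore have
real parts bounded above by explicit logarithms, and Harnack's inequality
(`norm_sub_le_of_re_nonneg`) bounds G = log F polynomially off the real axis. A maximum principle
argument then makes G affine. Reality of F removes the imaginary part of its slope; equal growth
along the two diagonals (`tendsto_re_diagonal_sub_div`) removes the real part.

Both the entireness of ξ and the growth of the coefficients rest on the resolvent estimate
`norm_inverse_le`. -/

namespace EntireOperator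

/-! ### Holomorphic logarithms -/

/-- A zero-free entire function has an entire logarithm. -/
theorem exists_entire_log {F : ℂ → ℂ} (hF : Differentiable ℂ F) (h0 : ∀ z, F z ≠ 0) :
    ∃ G : ℂ → ℂ, Differentiable ℂ G ∧ ∀ z, Complex.exp (G z) = F z := by
  have hd : Differentiable ℂ fun z => deriv F z / F z := hF.deriv.div hF h0
  obtain ⟨G, hG0, hG⟩ := hd.isExactOn_univ.with_val_at 0 (Complex.log (F 0))
  have hG' : Differentiable ℂ G := fun z => (hG z trivial).differentiableAt
  refine ⟨G, hG', fun z => ?_⟩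
  have key : ∀ w, HasDerivAt (fun z => Complex.exp (-G z) * F z) 0 w := fun w => by
    refine (((hG w trivial).neg.cexp).mul (hF w).hasDerivAt).congr_deriv ?_
    linear_combination Complex.exp (-G w) * (div_mul_cancel₀ (deriv F w) (h0 w)).symm
  have := is_const_of_deriv_eq_zero (fun w => (key w).differentiableAt)
    (fun w => (key w).deriv) z 0
  rw [hG0, Complex.exp_neg, Complex.exp_neg, Complex.exp_log (h0 0), inv_mul_cancel₀ (h0 0),
    inv_mul_eq_one₀ (Complex.exp_ne_zero _)] at this
  exact this

/-- A zero-free holomorphic function on a ball has a holomorphic logarithm. -/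
theorem exists_log_on_ball {F : ℂ → ℂ} {r : ℝ} (hr : 0 < r)
    (hF : DifferentiableOn ℂ F (Metric.ball 0 r)) (h0 : ∀ z ∈ Metric.ball (0 : ℂ) r, F z ≠ 0) :
    ∃ G : ℂ → ℂ, DifferentiableOn ℂ G (Metric.ball 0 r) ∧
      ∀ z ∈ Metric.ball (0 : ℂ) r, Complex.exp (G z) = F z := by
  have hd : DifferentiableOn ℂ (fun z => deriv F z / F z) (Metric.ball 0 r) :=
    (hF.deriv Metric.isOpen_ball).div hF h0
  obtain ⟨G, hG0, hG⟩ := hd.isExactOn_ball.with_val_at 0 (Complex.log (F 0))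
  have z0 : (0 : ℂ) ∈ Metric.ball (0 : ℂ) r := Metric.mem_ball_self hr
  refine ⟨G, fun z hz => (hG z hz).differentiableAt.differentiableWithinAt, fun z hz => ?_⟩
  have key : ∀ w ∈ Metric.ball (0 : ℂ) r,
      HasDerivAt (fun z => Complex.exp (-G z) * F z) 0 w := fun w hw => by
    have hFw : HasDerivAt F (deriv F w) w :=
      (hF.differentiableAt (Metric.isOpen_ball.mem_nhds hw)).hasDerivAt
    refine (((hG w hw).neg.cexp).mul hFw).congr_deriv ?_
    linear_combination Complex.exp (-G w) * (div_mul_cancel₀ (deriv F w) (h0 w hw)).symm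
  have := Metric.isOpen_ball.is_const_of_deriv_eq_zero (convex_ball (0 : ℂ) r).isPreconnected
    (fun w hw => (key w hw).differentiableAt.differentiableWithinAt)
    (fun w hw => (key w hw).deriv) hz z0
  rw [hG0, Complex.exp_neg, Complex.exp_neg, Complex.exp_log (h0 0 z0), inv_mul_cancel₀ (h0 0 z0),
    inv_mul_eq_one₀ (Complex.exp_ne_zero _)] at this
  exact this

/-! ### Harnack's inequality on the upper half-plane -/

theorem normSq_sub_conj (z w : ℂ) : ‖z - conj w‖ ^ 2 = ‖z - w‖ ^ 2 + 4 * z.im * w.im := by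
  rw [← Complex.normSq_eq_norm_sq, ← Complex.normSq_eq_norm_sq, Complex.normSq_apply,
    Complex.normSq_apply]
  simp
  ring

theorem sub_conj_ne_zero {z w : ℂ} (hz : 0 < z.im) (hw : 0 < w.im) : z - conj w ≠ 0 := by
  intro h
  have := congrArg Complex.im h
  simp at this
  linarith

theorem norm_sub_lt_norm_sub_conj {z w : ℂ} (hz : 0 < z.im) (hw : 0 < w.im) :
    ‖z - w‖ < ‖z - conj w‖ := by
  have := normSq_sub_conj z w
  have h2 := mul_pos hz hw
  exact lt_of_pow_lt_pow_left₀ 2 (norm_nonneg _) (by nlinarith)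

/-- The inverse Cayley transform, from the unit disc onto the upper half-plane, taking `0`
to `w`. -/
noncomputable def discToHalfPlane (w s : ℂ) : ℂ := (w - conj w * s) / (1 - s)

theorem one_sub_ne_zero_of_mem_ball {s : ℂ} (hs : s ∈ Metric.ball (0 : ℂ) 1) : 1 - s ≠ 0 := by
  intro h
  rw [sub_eq_zero] at h
  simp [← h] at hs

theorem discToHalfPlane_im_pos {w s : ℂ} (hw : 0 < w.im) (hs : s ∈ Metric.ball (0 : ℂ) 1) :
    0 < (discToHalfPlane w s).im := by
  have h1 := one_sub_ne_zero_of_mem_ball hs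
  have h3 : 0 < Complex.normSq (1 - s) := Complex.normSq_pos.2 h1
  have h2 : Complex.normSq s < 1 := by
    rw [Complex.normSq_eq_norm_sq]
    have : ‖s‖ < 1 := by simpa using hs
    nlinarith [norm_nonneg s]
  have : (discToHalfPlane w s).im = w.im * (1 - Complex.normSq s) / Complex.normSq (1 - s) := by
    rw [discToHalfPlane, Complex.div_im, ← sub_div]
    congr 1
    simp [Complex.normSq_apply]
    ring
  rw [this]
  exact div_pos (mul_pos hw (by linarith)) h3

theorem differentiableOn_discToHalfPlane (w : ℂ) :
    DifferentiableOn ℂ (discToHalfPlane w) (Metric.ball 0 1) := by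
  unfold discToHalfPlane
  exact DifferentiableOn.div (by fun_prop) (by fun_prop)
    (fun s hs => one_sub_ne_zero_of_mem_ball hs)

theorem discToHalfPlane_cayley {z w : ℂ} (hz : 0 < z.im) (hw : 0 < w.im) :
    discToHalfPlane w ((z - w) / (z - conj w)) = z := by
  have h1 := sub_conj_ne_zero hz hw
  have h2 : w - conj w ≠ 0 := sub_conj_ne_zero hw hw
  have h3 : 1 - (z - w) / (z - conj w) ≠ 0 := by
    rw [one_sub_div h1]
    exact div_ne_zero (by convert h2 using 1; ring) h1
  rw [discToHalfPlane, div_eq_iff h3]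
  field_simp
  ring

theorem cayley_mem_ball {z w : ℂ} (hz : 0 < z.im) (hw : 0 < w.im) :
    (z - w) / (z - conj w) ∈ Metric.ball (0 : ℂ) 1 := by
  rw [mem_ball_zero_iff, norm_div, div_lt_one (norm_pos_iff.2 (sub_conj_ne_zero hz hw))]
  exact norm_sub_lt_norm_sub_conj hz hw

/-- A zero-free holomorphic function on the upper half-plane has a holomorphic logarithm. -/
theorem exists_log_on_halfPlane {F : ℂ → ℂ} (hF : DifferentiableOn ℂ F {z | 0 < z.im})
    (h0 : ∀ z : ℂ, 0 < z.im → F z ≠ 0) :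
    ∃ G : ℂ → ℂ, DifferentiableOn ℂ G {z | 0 < z.im} ∧
      ∀ z : ℂ, 0 < z.im → Complex.exp (G z) = F z := by
  have hI : 0 < Complex.I.im := by simp
  obtain ⟨g, hg, hgF⟩ := exists_log_on_ball (F := F ∘ discToHalfPlane Complex.I) one_pos
    (hF.comp (differentiableOn_discToHalfPlane _) fun s hs => discToHalfPlane_im_pos hI hs)
    (fun s hs => h0 _ (discToHalfPlane_im_pos hI hs))
  refine ⟨fun z => g ((z - Complex.I) / (z - conj Complex.I)), ?_, fun z hz => ?_⟩
  · refine hg.comp (DifferentiableOn.div (by fun_prop) (by fun_prop) ?_) ?_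
    · exact fun z hz => sub_conj_ne_zero hz hI
    · exact fun z hz => cayley_mem_ball hz hI
  · rw [hgF _ (cayley_mem_ball hz hI), Function.comp_apply, discToHalfPlane_cayley hz hI]

/-- Harnack's inequality for holomorphic functions with nonnegative real part on the upper
half-plane. -/
theorem norm_sub_le_of_re_nonneg {P : ℂ → ℂ} (hP : DifferentiableOn ℂ P {z | 0 < z.im})
    (hre : ∀ z : ℂ, 0 < z.im → 0 ≤ (P z).re) {z w : ℂ} (hz : 0 < z.im) (hw : 0 < w.im) :
    ‖P z - P w‖ ≤ (P w).re * (‖z - conj w‖ ^ 2 / (z.im * w.im)) := by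
  set d := discToHalfPlane w
  have hd0 : d 0 = w := by simp [d, discToHalfPlane]
  have hyv := mul_pos hz hw
  -- Borel–Carathéodory needs a strictly positive bound, while Re P(w) may be 0; hence the slack δ,
  -- removed at the end by a limit.
  have key : ∀ δ : ℝ, 0 < δ →
      ‖P z - P w‖ ≤ ((P w).re + δ) * (‖z - conj w‖ ^ 2 / (z.im * w.im)) := by
    intro δ hδ
    have hM : 0 < (P w).re + δ := by linarith [hre w hw]
    have hb := Complex.borelCaratheodory_zero (f := fun s => -(P (d s) - P w)) hM
      ((hP.comp (differentiableOn_discToHalfPlane _)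
        fun s hs => discToHalfPlane_im_pos hw hs).sub_const _).neg
      (fun s hs => by
        have := hre _ (discToHalfPlane_im_pos hw hs)
        simp only [Set.mem_ofPred_eq, Complex.neg_re, Complex.sub_re]
        show -((P (discToHalfPlane w s)).re - _) ≤ _
        linarith) one_pos (cayley_mem_ball hz hw) (by simp [hd0])
    simp only [d, discToHalfPlane_cayley hz hw, norm_neg] at hb
    refine hb.trans ?_
    have h1 := norm_sub_lt_norm_sub_conj hz hw
    have h2 := normSq_sub_conj z w
    have h3 := norm_nonneg (z - w)
    rw [norm_div]
    set a := ‖z - w‖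
    set b := ‖z - conj w‖
    have hb : 0 < b := by linarith
    have : 2 * ((P w).re + δ) * (a / b) / (1 - a / b) = ((P w).re + δ) * (2 * a / (b - a)) := by
      have : b - a ≠ 0 := by linarith
      field_simp
    rw [this]
    refine mul_le_mul_of_nonneg_left ?_ hM.le
    rw [div_le_div_iff₀ (by linarith) hyv]
    -- With Im z · Im w = (b² - a²)/4 the claim becomes 2b² - ab - a² ≥ 0, and the left side factors
    -- as (b - a)(2b + a).
    have h4 : z.im * w.im = (b - a) * (b + a) / 4 := by linarith
    have h5 : 0 ≤ (b - a) * ((b - a) * (2 * b + a)) := by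
      have := sub_pos.2 h1
      positivity
    rw [h4]
    nlinarith
  have hlim : Tendsto (fun δ : ℝ => ((P w).re + δ) * (‖z - conj w‖ ^ 2 / (z.im * w.im))) (𝓝[>] 0)
      (𝓝 (((P w).re + 0) * (‖z - conj w‖ ^ 2 / (z.im * w.im)))) := by
    refine Tendsto.mono_left ?_ nhdsWithin_le_nhds
    exact Continuous.tendsto (by fun_prop) 0
  rw [add_zero] at hlim
  exact ge_of_tendsto hlim (by filter_upwards [self_mem_nhdsWithin] with δ hδ using key δ hδ)

/-- A holomorphic function on the upper half-plane with nonnegative real part has the same growth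
along the two diagonals. -/
theorem tendsto_re_diagonal_sub_div {P : ℂ → ℂ} (hP : DifferentiableOn ℂ P {z | 0 < z.im})
    (hre : ∀ z : ℂ, 0 < z.im → 0 ≤ (P z).re) :
    Tendsto (fun R : ℝ => ((P ⟨R, R⟩).re - (P ⟨-R, R⟩).re) / R) atTop (𝓝 0) := by
  set S : Set ℝ := (fun z : ℂ => (P z).re / z.im) '' {z | 0 < z.im}
  have hSne : S.Nonempty := ⟨_, Complex.I, by simp, rfl⟩
  have hSb : BddBelow S := ⟨0, by rintro _ ⟨z, hz, rfl⟩; exact div_nonneg (hre z hz) (le_of_lt hz)⟩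
  set c := sInf S
  have hc : ∀ z : ℂ, 0 < z.im → c * z.im ≤ (P z).re := fun z hz =>
    (le_div_iff₀ hz).1 (csInf_le hSb ⟨z, hz, rfl⟩)
  -- This removes from Re P the largest multiple of Im z that keeps it nonnegative; what remains is
  -- o(R) on the diagonals. The removed term takes the same value at R + iR and at -R + iR.
  set Q : ℂ → ℂ := fun z => P z + Complex.I * c * z
  have hQ : DifferentiableOn ℂ Q {z | 0 < z.im} := hP.add (by fun_prop)
  have hQre : ∀ z, (Q z).re = (P z).re - c * z.im := fun z => by simp [Q]; ring
  have hQ0 : ∀ z : ℂ, 0 < z.im → 0 ≤ (Q z).re := fun z hz => by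
    rw [hQre]; linarith [hc z hz]
  have hdiag : ∀ R : ℝ, ((P ⟨R, R⟩).re - (P ⟨-R, R⟩).re) / R =
      ((Q ⟨R, R⟩).re - (Q ⟨-R, R⟩).re) / R := fun R => by rw [hQre, hQre]; simp
  simp only [hdiag]
  rw [Metric.tendsto_nhds]
  intro ε hε
  -- The base point w nearly attains the infimum, so Re Q(w) is at most (ε/8) Im w; Harnack from w
  -- loses only a factor of order R / Im w.
  obtain ⟨_, ⟨w, hw, rfl⟩, hlt⟩ := exists_lt_of_csInf_lt hSne (lt_add_of_pos_right c
    (show 0 < ε / 8 by positivity))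
  have hw' : 0 < w.im := hw
  have hQw : (Q w).re ≤ ε / 8 * w.im := by
    rw [hQre]
    have := (div_lt_iff₀ hw').1 hlt
    nlinarith
  set N := ‖w‖
  filter_upwards [eventually_ge_atTop (max 1 (100 * (N + 1) ^ 2))] with R hR
  have hR1 : 1 ≤ R := (le_max_left _ _).trans hR
  have hR2 : 100 * (N + 1) ^ 2 ≤ R := (le_max_right _ _).trans hR
  have hN : 0 ≤ N := norm_nonneg w
  have hwN : w.im ≤ N := (le_abs_self _).trans (Complex.abs_im_le_norm w)
  have hbound : ∀ x : ℝ, |x| = R → (Q ⟨x, R⟩).re ≤ ε / 2 * R := by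
    intro x hx
    have hz : (0 : ℝ) < (⟨x, R⟩ : ℂ).im := by show 0 < R; linarith
    have hh := norm_sub_le_of_re_nonneg hQ hQ0 hz hw'
    have h1 : (Q ⟨x, R⟩).re - (Q w).re ≤ ‖Q ⟨x, R⟩ - Q w‖ := by
      rw [← Complex.sub_re]; exact Complex.re_le_norm _
    have h2 : ‖(⟨x, R⟩ : ℂ) - conj w‖ ^ 2 ≤ 3 * R ^ 2 := by
      have h3 : ‖(⟨x, R⟩ : ℂ)‖ ^ 2 = 2 * R ^ 2 := by
        rw [← Complex.normSq_eq_norm_sq, Complex.normSq_mk, ← abs_mul_abs_self x, hx]; ring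
      have h4 : ‖(⟨x, R⟩ : ℂ) - conj w‖ ≤ ‖(⟨x, R⟩ : ℂ)‖ + N := by
        refine (norm_sub_le _ _).trans_eq ?_
        rw [Complex.norm_conj]
      have h5 : ‖(⟨x, R⟩ : ℂ)‖ ≤ 3 / 2 * R :=
        abs_le_of_sq_le_sq' (by nlinarith) (by linarith) |>.2
      have h6 := norm_nonneg ((⟨x, R⟩ : ℂ) - conj w)
      have h7 : N ≤ R / 100 := by nlinarith
      have h8 : ‖(⟨x, R⟩ : ℂ) - conj w‖ ≤ 8 / 5 * R := by linarith
      nlinarith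
    have h3 : (Q w).re * (‖(⟨x, R⟩ : ℂ) - conj w‖ ^ 2 / ((⟨x, R⟩ : ℂ).im * w.im)) ≤
        (ε / 8 * w.im) * (3 * R ^ 2 / (R * w.im)) := by
      have := hQ0 w hw'
      show (Q w).re * (‖(⟨x, R⟩ : ℂ) - conj w‖ ^ 2 / (R * w.im)) ≤ _
      have : 0 < R * w.im := by positivity
      gcongr
    have h4 : (ε / 8 * w.im) * (3 * R ^ 2 / (R * w.im)) = 3 * ε / 8 * R := by
      field_simp
    have h5 : ε / 8 * w.im ≤ ε / 8 * R := by
      gcongr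
      nlinarith
    linarith
  have ha := hbound R (abs_of_pos (by linarith))
  have hb := hbound (-R) (by rw [abs_neg]; exact abs_of_pos (by linarith))
  have ha0 := hQ0 ⟨R, R⟩ (by show 0 < R; linarith)
  have hb0 := hQ0 ⟨-R, R⟩ (by show 0 < R; linarith)
  have hRp : 0 < R := by linarith
  rw [Real.dist_eq, sub_zero, abs_div, abs_of_pos hRp, div_lt_iff₀ hRp, abs_lt]
  have : 0 < ε * R := by positivity
  constructor <;> linarith

/-! ### Liouville-type theorems -/

/-- An entire function with at most linear growth is affine. -/
theorem exists_affine_of_linear_growth {G : ℂ → ℂ} (hG : Differentiable ℂ G) {K : ℝ}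
    (hK : ∀ z, ‖G z‖ ≤ K * (1 + ‖z‖)) : ∃ g : ℂ, ∀ z, G z = G 0 + g * z := by
  have hK0 : 0 ≤ K := by simpa using (norm_nonneg _).trans (hK 0)
  have hb : ∀ c, ‖deriv G c‖ ≤ 2 * K := fun c => by
    have hR : 0 < 1 + ‖c‖ := by positivity
    have := Complex.norm_deriv_le_of_forall_mem_sphere_norm_le (C := 2 * K * (1 + ‖c‖)) hR
      hG.diffContOnCl fun z hz => by
        refine (hK z).trans ?_
        have h1 : ‖z‖ ≤ ‖z - c‖ + ‖c‖ := by simpa using norm_add_le (z - c) c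
        rw [mem_sphere_iff_norm] at hz
        nlinarith
    rwa [mul_div_assoc, div_self hR.ne', mul_one] at this
  have hconst : ∀ z, deriv G z = deriv G 0 := fun z =>
    hG.deriv.apply_eq_apply_of_bounded
      (isBounded_iff_forall_norm_le.2 ⟨2 * K, by rintro _ ⟨z, rfl⟩; exact hb z⟩) z 0
  refine ⟨deriv G 0, fun z => ?_⟩
  have key : ∀ w, HasDerivAt (fun z => G z - deriv G 0 * z) 0 w := fun w =>
    ((hG w).hasDerivAt.sub ((hasDerivAt_id w).const_mul (deriv G 0))).congr_deriv
      (by simp [hconst w])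
  have := is_const_of_deriv_eq_zero (fun w => (key w).differentiableAt)
    (fun w => (key w).deriv) z 0
  simp only [mul_zero, sub_zero] at this
  linear_combination this

/-- An entire function which is `O(|z|² / |Im z|)` away from the real axis, with at most a double
pole singularity at the axis, is affine. -/
theorem exists_affine_of_growth_off_real {G : ℂ → ℂ} (hG : Differentiable ℂ G) {K : ℝ}
    (hK : ∀ z : ℂ, z.im ≠ 0 → ‖G z‖ ≤ K * (1 + ‖z‖ ^ 2) * (1 / |z.im| + 1 / |z.im| ^ 2)) :
    ∃ g : ℂ, ∀ z, G z = G 0 + g * z := by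
  have hK0 : 0 ≤ K := by
    have := (norm_nonneg _).trans (hK Complex.I (by simp))
    norm_num at this
    linarith
  have key : ∀ R : ℝ, 1 ≤ R → ∀ z : ℂ, ‖z‖ ≤ R / 2 → ‖G z‖ ≤ 32 * K * R := by
    intro R hR z hz
    -- On |z| = R one has z² - R² = z(z - z̄), of modulus 2R|Im z|; its square cancels the double
    -- singularity of the bound at the axis.
    have hf : Differentiable ℂ fun z => (z ^ 2 - (R : ℂ) ^ 2) ^ 2 * G z := by fun_prop
    have hmax := Complex.norm_le_of_forall_mem_frontier_norm_le (U := Metric.ball (0 : ℂ) R)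
      (C := 16 * K * R ^ 5) Metric.isBounded_ball hf.diffContOnCl (fun w hw => by
        rw [frontier_ball _ (by linarith), mem_sphere_zero_iff_norm] at hw
        have h1 : w ^ 2 - (R : ℂ) ^ 2 = w * (w - conj w) := by
          rw [mul_sub, Complex.mul_conj, Complex.normSq_eq_norm_sq, hw]; push_cast; ring
        have h2 : ‖w - conj w‖ = 2 * |w.im| := by
          rw [Complex.sub_conj]; simp
        rw [norm_mul, norm_pow, h1, norm_mul, h2, hw]
        by_cases h0 : w.im = 0
        · simp only [h0, abs_zero, mul_zero, ne_eq, OfNat.ofNat_ne_zero, not_false_eq_true,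
            zero_pow, zero_mul]
          positivity
        · have hy : 0 < |w.im| := abs_pos.2 h0
          have hyR : |w.im| ≤ R := hw ▸ Complex.abs_im_le_norm w
          calc (R * (2 * |w.im|)) ^ 2 * ‖G w‖
              ≤ (R * (2 * |w.im|)) ^ 2 *
                (K * (1 + R ^ 2) * (1 / |w.im| + 1 / |w.im| ^ 2)) := by
                gcongr
                rw [← hw]
                exact hK w h0
            _ = 4 * K * R ^ 2 * ((1 + R ^ 2) * (|w.im| + 1)) := by field_simp; ring
            _ ≤ 4 * K * R ^ 2 * ((R ^ 2 + R ^ 2) * (R + R)) := by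
                gcongr
                nlinarith
            _ = 16 * K * R ^ 5 := by ring)
      (subset_closure (show z ∈ Metric.ball (0 : ℂ) R by
        rw [mem_ball_zero_iff]; linarith))
    rw [norm_mul, norm_pow] at hmax
    have h3 : 3 / 4 * R ^ 2 ≤ ‖z ^ 2 - (R : ℂ) ^ 2‖ := by
      have := norm_sub_norm_le ((R : ℂ) ^ 2) (z ^ 2)
      rw [norm_sub_rev, norm_pow, norm_pow, Complex.norm_real, Real.norm_eq_abs, sq_abs] at this
      nlinarith [norm_nonneg z]
    have h4 : (3 / 4 * R ^ 2) ^ 2 * ‖G z‖ ≤ 16 * K * R ^ 5 := by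
      refine le_trans ?_ hmax
      gcongr
    have h5 : 0 < R ^ 4 := by positivity
    have h6 : R ^ 4 * ‖G z‖ ≤ R ^ 4 * (32 * K * R) := by
      have : 0 ≤ K * R ^ 5 := by positivity
      nlinarith
    exact le_of_mul_le_mul_left h6 h5
  refine exists_affine_of_linear_growth hG (K := 64 * K) fun z => ?_
  refine (key (2 * (1 + ‖z‖)) (by linarith [norm_nonneg z]) z (by linarith)).trans ?_
  linarith

/-! ### Quotients of zero-free functions of moderate growth -/

/-- For `exp (α z)` of size `C (1 + |z|) / Im z`, this function has nonnegative real part on the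
upper half-plane. -/
noncomputable def shiftedLog (C ε : ℝ) (α : ℂ → ℂ) (z : ℂ) : ℂ :=
  Real.log (3 * C / ε) + Complex.log (z + Complex.I) - α (z + ε * Complex.I)

section shiftedLog

variable {α : ℂ → ℂ} {C ε : ℝ}

theorem differentiableOn_shiftedLog (hα : DifferentiableOn ℂ α {z | 0 < z.im}) (hε : 0 < ε) :
    DifferentiableOn ℂ (shiftedLog C ε α) {z | 0 < z.im} := by
  refine DifferentiableOn.sub (DifferentiableOn.add (by fun_prop) ?_) ?_
  · refine DifferentiableOn.clog (by fun_prop) fun z hz => ?_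
    right
    have : 0 < z.im := hz
    simp
    linarith
  · refine hα.comp (by fun_prop) fun z hz => ?_
    have : 0 < z.im := hz
    simp
    linarith

theorem shiftedLog_re (C ε : ℝ) (α : ℂ → ℂ) (z : ℂ) : (shiftedLog C ε α z).re =
    Real.log (3 * C / ε) + Real.log ‖z + Complex.I‖ - (α (z + ε * Complex.I)).re := by
  simp only [shiftedLog, Complex.sub_re, Complex.add_re, Complex.ofReal_re, Complex.log_re]

/-- Raising the argument by iε keeps the imaginary part above ε, so the singular bound becomes
(3C/ε)|z + i|, whose logarithm is the real part of a holomorphic function. -/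
theorem shiftedLog_re_nonneg (hC : 0 < C) (hε : 0 < ε) (hε1 : ε ≤ 1)
    (hα : ∀ z : ℂ, 0 < z.im → ‖Complex.exp (α z)‖ ≤ C * (1 + ‖z‖) / z.im) {z : ℂ}
    (hz : 0 < z.im) : 0 ≤ (shiftedLog C ε α z).re := by
  have him : (z + ε * Complex.I).im = z.im + ε := by simp
  have h1 := hα (z + ε * Complex.I) (by rw [him]; linarith)
  rw [him, Complex.norm_exp] at h1
  have hnim : 1 + z.im ≤ ‖z + Complex.I‖ := by
    refine le_trans (le_of_eq ?_) (Complex.im_le_norm _)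
    simp [add_comm]
  have hnz : ‖z‖ ≤ ‖z + Complex.I‖ := by
    refine le_of_sq_le_sq ?_ (norm_nonneg _)
    rw [← Complex.normSq_eq_norm_sq, ← Complex.normSq_eq_norm_sq, Complex.normSq_apply,
      Complex.normSq_apply]
    simp
    nlinarith
  have hshift : ‖z + ε * Complex.I‖ ≤ ‖z‖ + ε := by
    refine (norm_add_le _ _).trans_eq ?_
    simp [abs_of_pos hε]
  have hpos : 0 < ‖z + Complex.I‖ := by linarith
  have h2 : Real.exp (α (z + ε * Complex.I)).re ≤ 3 * C / ε * ‖z + Complex.I‖ := by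
    refine h1.trans ?_
    rw [div_mul_eq_mul_div]
    have : 0 ≤ C * (1 + ‖z + ε * Complex.I‖) := by positivity
    refine div_le_div₀ (by positivity) ?_ hε (by linarith)
    nlinarith
  rw [shiftedLog_re, ← Real.log_mul (by positivity) hpos.ne', sub_nonneg,
    Real.le_log_iff_exp_le (by positivity)]
  exact h2

/-- Growth of the logarithm of a quotient of two zero-free functions of moderate growth on the
upper half-plane. -/
theorem norm_sub_le_of_exp_quotient {G β : ℂ → ℂ} (hG : Differentiable ℂ G)
    (hβ : DifferentiableOn ℂ β {z | 0 < z.im}) (hC : 0 < C)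
    (hb : ∀ z : ℂ, 0 < z.im → ‖Complex.exp (β z)‖ ≤ C * (1 + ‖z‖) / z.im)
    (ha : ∀ z : ℂ, 0 < z.im → ‖Complex.exp (G z + β z)‖ ≤ C * (1 + ‖z‖) / z.im) :
    ∃ K : ℝ, 0 ≤ K ∧ ∀ z : ℂ, 0 < z.im →
      ‖G z - G Complex.I‖ ≤ K * (1 + ‖z‖ ^ 2) * (1 / z.im + 1 / z.im ^ 2) := by
  have hα : DifferentiableOn ℂ (fun z => G z + β z) {z | 0 < z.im} := hG.differentiableOn.add hβ
  set Mα := 3 * C + 1 + ‖G Complex.I + β Complex.I‖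
  set Mβ := 3 * C + 1 + ‖β Complex.I‖
  refine ⟨16 * (Mα + Mβ), by positivity, fun w hw => ?_⟩
  -- The shift must leave both w - iε and i - iε in the upper half-plane, with imaginary parts
  -- comparable to Im w and 1.
  set ε : ℝ := min 1 w.im / 2
  have hm : 0 < min 1 w.im := lt_min one_pos hw
  have hε : 0 < ε := by positivity
  have hε1 : ε ≤ 1 / 2 := by have := min_le_left 1 w.im; simp only [ε]; linarith
  have hε2 : ε ≤ w.im / 2 := by have := min_le_right 1 w.im; simp only [ε]; linarith
  have hεinv : 1 / ε ≤ 2 * (1 + 1 / w.im) := by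
    have : 1 / min 1 w.im ≤ 1 + 1 / w.im := by
      have := one_div_pos.2 hw
      rcases min_choice 1 w.im with h | h <;> rw [h]
      · linarith
      · linarith
    simp only [ε]
    rw [one_div_div, div_eq_mul_one_div]
    linarith
  set z : ℂ := w - ε * Complex.I
  set z₀ : ℂ := (1 - ε : ℝ) * Complex.I
  have hz : 0 < z.im := by simp [z]; linarith
  have hz₀ : 0 < z₀.im := by simp [z₀]; linarith
  have hzw : z + ε * Complex.I = w := by simp [z]
  have hz₀I : z₀ + ε * Complex.I = Complex.I := by simp [z₀]; ring
  have hP := norm_sub_le_of_re_nonneg (differentiableOn_shiftedLog (C := C) hα hε)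
    (fun z hz => shiftedLog_re_nonneg hC hε (by linarith) ha hz) hz hz₀
  have hQ := norm_sub_le_of_re_nonneg (differentiableOn_shiftedLog (C := C) hβ hε)
    (fun z hz => shiftedLog_re_nonneg hC hε (by linarith) hb hz) hz hz₀
  have hre : ∀ α : ℂ → ℂ, (shiftedLog C ε α z₀).re ≤ (3 * C + 1 + ‖α Complex.I‖) / ε := by
    intro α
    rw [shiftedLog_re, hz₀I]
    have h1 : Real.log (3 * C / ε) ≤ 3 * C / ε := Real.log_le_self (by positivity)
    have h2 : Real.log ‖z₀ + Complex.I‖ ≤ 1 := by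
      have : z₀ + Complex.I = (2 - ε : ℝ) * Complex.I := by simp [z₀]; ring
      rw [this, norm_mul, Complex.norm_I, mul_one, Complex.norm_real, Real.norm_eq_abs,
        abs_of_pos (by linarith)]
      exact (Real.log_le_sub_one_of_pos (by linarith)).trans (by linarith)
    have h3 : -(α Complex.I).re ≤ ‖α Complex.I‖ :=
      (neg_le_abs _).trans (Complex.abs_re_le_norm _)
    have h4 : 1 + ‖α Complex.I‖ ≤ (1 + ‖α Complex.I‖) / ε :=
      le_div_self (by positivity) hε (by linarith)
    rw [add_assoc, add_div]
    linarith
  -- The majorants in the two shifted logarithms coincide and cancel, leaving only G.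
  have hdiff : G w - G Complex.I = (shiftedLog C ε β z - shiftedLog C ε β z₀) -
      (shiftedLog C ε (fun z => G z + β z) z - shiftedLog C ε (fun z => G z + β z) z₀) := by
    simp only [shiftedLog, hzw, hz₀I]
    ring
  set q := ‖z - conj z₀‖ ^ 2 / (z.im * z₀.im)
  have hq : q ≤ 8 * (1 + ‖w‖ ^ 2) / w.im := by
    have h1 : ‖z - conj z₀‖ ≤ ‖w‖ + 1 := by
      have : z - conj z₀ = w + (1 - 2 * ε : ℝ) * Complex.I := by
        simp [z, z₀]; ring
      rw [this]
      refine (norm_add_le _ _).trans ?_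
      rw [norm_mul, Complex.norm_I, mul_one, Complex.norm_real, Real.norm_eq_abs]
      gcongr
      rw [abs_le]
      constructor <;> linarith
    have h2 : ‖z - conj z₀‖ ^ 2 ≤ 2 * (1 + ‖w‖ ^ 2) := by
      have := norm_nonneg (z - conj z₀)
      nlinarith [sq_nonneg (‖w‖ - 1)]
    have h3 : w.im / 4 ≤ z.im * z₀.im := by
      have e1 : z.im = w.im - ε := by simp [z]
      have e2 : z₀.im = 1 - ε := by simp [z₀]
      rw [e1, e2]
      nlinarith
    calc q ≤ 2 * (1 + ‖w‖ ^ 2) / (w.im / 4) := div_le_div₀ (by positivity) h2 (by positivity) h3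
      _ = _ := by field_simp; ring
  have hq0 : 0 ≤ q := by positivity
  have hsum : ‖G w - G Complex.I‖ ≤ (Mα + Mβ) / ε * q := by
    rw [hdiff]
    refine (norm_sub_le _ _).trans ?_
    have e1 := mul_le_mul_of_nonneg_right (hre (fun z => G z + β z)) hq0
    have e2 := mul_le_mul_of_nonneg_right (hre β) hq0
    calc _ ≤ _ := add_le_add (hQ.trans e2) (hP.trans e1)
      _ = _ := by simp only [Mα, Mβ]; ring
  refine hsum.trans ?_
  have hMM : 0 ≤ Mα + Mβ := by positivity
  calc (Mα + Mβ) / ε * q = (Mα + Mβ) * (1 / ε) * q := by ring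
    _ ≤ (Mα + Mβ) * (2 * (1 + 1 / w.im)) * (8 * (1 + ‖w‖ ^ 2) / w.im) := by gcongr
    _ = _ := by field_simp; ring

end shiftedLog

/-- An entire function without zeros, real on the real axis, which is a quotient of zero-free
functions of moderate growth in the upper half-plane, is constant. -/
theorem const_of_quotient_moderate_growth {F a b : ℂ → ℂ} (hF : Differentiable ℂ F)
    (hF0 : ∀ z, F z ≠ 0) (hFreal : ∀ z : ℂ, 0 < z.im → F (conj z) = conj (F z))
    (hb : DifferentiableOn ℂ b {z | 0 < z.im}) (hb0 : ∀ z : ℂ, 0 < z.im → b z ≠ 0)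
    (hab : ∀ z : ℂ, 0 < z.im → a z = F z * b z) {C : ℝ} (hC : 0 < C)
    (haC : ∀ z : ℂ, 0 < z.im → ‖a z‖ ≤ C * (1 + ‖z‖) / z.im)
    (hbC : ∀ z : ℂ, 0 < z.im → ‖b z‖ ≤ C * (1 + ‖z‖) / z.im) (z : ℂ) : F z = F 0 := by
  obtain ⟨G, hG, hGF⟩ := exists_entire_log hF hF0
  obtain ⟨β, hβ, hβb⟩ := exists_log_on_halfPlane hb hb0
  have hbC' : ∀ z : ℂ, 0 < z.im → ‖Complex.exp (β z)‖ ≤ C * (1 + ‖z‖) / z.im := fun z hz => by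
    rw [hβb z hz]; exact hbC z hz
  have haC' : ∀ z : ℂ, 0 < z.im → ‖Complex.exp (G z + β z)‖ ≤ C * (1 + ‖z‖) / z.im :=
    fun z hz => by
      rw [Complex.exp_add, hβb z hz, hGF, ← hab z hz]; exact haC z hz
  -- The lower half-plane is handled by reflection: F is real, so the reflected G is another
  -- logarithm of F on the upper half-plane.
  have hG' : Differentiable ℂ (conj ∘ G ∘ conj) := fun z =>
    differentiableAt_conj_conj_iff.2 (hG (conj z))
  obtain ⟨K, hK0, hK⟩ := norm_sub_le_of_exp_quotient hG hβ hC hbC' haC'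
  obtain ⟨K', hK0', hK'⟩ := norm_sub_le_of_exp_quotient hG' hβ hC hbC' fun z hz => by
    have : Complex.exp ((conj ∘ G ∘ conj) z) = Complex.exp (G z) := by
      simp only [Function.comp_apply]
      rw [Complex.exp_conj, hGF, hGF, hFreal z hz, Complex.conj_conj]
    rw [Complex.exp_add, this, ← Complex.exp_add]
    exact haC' z hz
  set D := ‖G (-Complex.I) - G Complex.I‖
  have hbound : ∀ z : ℂ, z.im ≠ 0 → ‖G z - G Complex.I‖ ≤
      (K + K' + D) * (1 + ‖z‖ ^ 2) * (1 / |z.im| + 1 / |z.im| ^ 2) := by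
    intro z hz
    have hy : 0 < |z.im| := abs_pos.2 hz
    set W := (1 + ‖z‖ ^ 2) * (1 / |z.im| + 1 / |z.im| ^ 2)
    have hW1 : 1 ≤ W := by
      have h1 : |z.im| ≤ ‖z‖ := Complex.abs_im_le_norm z
      have h2 : 1 ≤ (1 + |z.im| ^ 2) * (1 / |z.im| ^ 2) := by
        rw [mul_one_div, le_div_iff₀ (by positivity)]; linarith
      refine h2.trans ?_
      simp only [W]
      gcongr
      have : 0 ≤ 1 / |z.im| := by positivity
      linarith
    have hW0 : 0 ≤ W := by linarith
    rw [mul_assoc]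
    change _ ≤ (K + K' + D) * W
    have hD : 0 ≤ D := norm_nonneg _
    rcases lt_or_gt_of_ne hz with h | h
    · have h1 := hK' (conj z) (by simpa using h)
      have h2 : ‖G z - G (-Complex.I)‖ ≤ K' * W := by
        have e : (conj ∘ G ∘ conj) (conj z) - (conj ∘ G ∘ conj) Complex.I =
            conj (G z - G (-Complex.I)) := by simp
        rw [e, Complex.norm_conj, Complex.norm_conj, Complex.conj_im, ← abs_of_neg h,
          mul_assoc] at h1
        exact h1
      have h3 : ‖G z - G Complex.I‖ ≤ ‖G z - G (-Complex.I)‖ + D := by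
        simpa using norm_add_le (G z - G (-Complex.I)) (G (-Complex.I) - G Complex.I)
      nlinarith [mul_nonneg hK0 hW0]
    · have h1 := hK z h
      rw [← abs_of_pos h, mul_assoc] at h1
      change _ ≤ K * W at h1
      nlinarith [mul_nonneg hK0' hW0, mul_nonneg hD hW0]
  obtain ⟨g, hg⟩ := exists_affine_of_growth_off_real (hG.sub_const _) hbound
  have hg' : ∀ z, G z = G 0 + g * z := fun z => by linear_combination hg z
  -- Compare |F(i)| with |F(-i)|.
  have him : g.im = 0 := by
    have h1 := congrArg norm (hFreal Complex.I (by simp))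
    rw [Complex.norm_conj, ← hGF, ← hGF, Complex.norm_exp, Complex.norm_exp,
      Real.exp_injective.eq_iff, hg', hg' Complex.I] at h1
    simp at h1
    linarith
  have hP := tendsto_re_diagonal_sub_div (differentiableOn_shiftedLog (C := C)
    (hG.differentiableOn.add hβ) one_pos)
    fun z hz => shiftedLog_re_nonneg hC one_pos le_rfl haC' hz
  have hQ := tendsto_re_diagonal_sub_div (differentiableOn_shiftedLog (C := C) hβ one_pos)
    fun z hz => shiftedLog_re_nonneg hC one_pos le_rfl hbC' hz
  -- The difference of the two shifted logarithms has real part Re G(z + i); between the diagonal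
  -- points at height R it changes by 2R Re g, which must be o(R).
  have hre : g.re = 0 := by
    have hlim := hQ.sub hP
    rw [sub_zero] at hlim
    have hc : Tendsto (fun _ : ℝ => 2 * g.re) atTop (𝓝 0) := by
      refine hlim.congr' ?_
      filter_upwards [eventually_gt_atTop 0] with R hR
      rw [← sub_div, div_eq_iff hR.ne']
      simp only [shiftedLog_re, Pi.add_apply, Complex.add_re, hg' (_ + _), Complex.mul_re]
      simp [him]
      ring
    have := tendsto_nhds_unique hc tendsto_const_nhds
    linarith
  have hg0 : g = 0 := Complex.ext hre him
  rw [← hGF, ← hGF, hg' z, hg0, zero_mul, add_zero]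

/-! ### Linear relations and their adjoints -/

section Relations

variable {H : Type*} [NormedAddCommGroup H] [InnerProductSpace ℂ H]

theorem mem_shift {B : Submodule ℂ (H × H)} {z : ℂ} {x y : H} :
    (x, y) ∈ shift B z ↔ (x, y + z • x) ∈ B := by
  simp only [shift, Submodule.mem_map, Prod.exists]
  constructor
  · rintro ⟨a, b, hab, h⟩
    obtain ⟨h1, h2⟩ := Prod.ext_iff.1 h
    change a = x at h1
    change b - z • a = y at h2
    rw [← h1, ← h2, sub_add_cancel]
    exact hab
  · intro h
    exact ⟨_, _, h, by simp⟩

theorem mem_ker_shift {B : Submodule ℂ (H × H)} {z : ℂ} {x : H} :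
    x ∈ ker (shift B z) ↔ (x, z • x) ∈ B := by
  change (x, 0) ∈ shift B z ↔ _
  rw [mem_shift, zero_add]

theorem mem_ran_shift {B : Submodule ℂ (H × H)} {z : ℂ} {y : H} :
    y ∈ ran (shift B z) ↔ ∃ x, (x, y + z • x) ∈ B := by
  simp only [ran, Submodule.mem_map, Prod.exists, LinearMap.snd_apply, mem_shift]
  constructor
  · rintro ⟨a, b, h, rfl⟩
    exact ⟨a, h⟩
  · rintro ⟨x, h⟩
    exact ⟨x, y, h, rfl⟩

theorem isResolvent_iff {B : Submodule ℂ (H × H)} {z : ℂ} {R : H →L[ℂ] H} :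
    IsResolvent B z R ↔ ∀ x y, (y, x + z • y) ∈ B ↔ y = R x := by
  have hinv : ∀ x y, (x, y) ∈ inv (shift B z) ↔ (y, x + z • y) ∈ B := by
    intro x y
    rw [← mem_shift]
    simp only [inv, Submodule.mem_map, Prod.exists]
    constructor
    · rintro ⟨a, b, hab, h⟩
      simp only [LinearEquiv.coe_coe, LinearEquiv.prodComm_apply, Prod.swap_prod_mk,
        Prod.mk.injEq] at h
      rw [← h.1, ← h.2]
      exact hab
    · intro h
      exact ⟨y, x, h, rfl⟩
  simp only [IsResolvent, SetLike.ext_iff, Prod.forall, hinv, LinearMap.mem_graph_iff,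
    ContinuousLinearMap.coe_coe]

theorem isResolvent_resolventOp {B : Submodule ℂ (H × H)} {z : ℂ} (hz : z ∉ spec B) :
    IsResolvent B z (resolventOp B z) := by
  have h : ∃ R : H →L[ℂ] H, IsResolvent B z R := not_not.1 hz
  rw [resolventOp, dif_pos h]
  exact h.choose_spec

theorem mem_iff_eq_resolventOp {B : Submodule ℂ (H × H)} {z : ℂ} (hz : z ∉ spec B) {x y : H} :
    (y, x + z • y) ∈ B ↔ y = resolventOp B z x :=
  isResolvent_iff.1 (isResolvent_resolventOp hz) x y

theorem mem_ran_shift_graph {A : H →ₗ.[ℂ] H} {z : ℂ} {y : H} :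
    y ∈ ran (shift A.graph z) ↔ ∃ x : A.domain, A x - z • (x : H) = y := by
  rw [mem_ran_shift]
  constructor
  · rintro ⟨x, h⟩
    obtain ⟨x', rfl, h⟩ := (LinearPMap.mem_graph_iff _).1 h
    exact ⟨x', by rw [h, add_sub_cancel_right]⟩
  · rintro ⟨x, rfl⟩
    exact ⟨x, (LinearPMap.mem_graph_iff _).2 ⟨x, rfl, by simp⟩⟩

theorem inner_eq_of_mem_adjoint {B : Submodule ℂ (H × H)} {p q : H × H} (hp : p ∈ B)
    (hq : q ∈ B.adjoint) : inner ℂ p.2 q.1 = inner ℂ p.1 q.2 :=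
  sub_eq_zero.1 ((Submodule.mem_adjoint_iff B q).1 hq p.1 p.2 hp)

theorem ker_shift_adjoint (A : H →ₗ.[ℂ] H) (z : ℂ) :
    ker (shift A.graph.adjoint z) = (ran (shift A.graph (conj z)))ᗮ := by
  ext η
  rw [mem_ker_shift, Submodule.mem_adjoint_iff, Submodule.mem_orthogonal]
  constructor
  · rintro h u hu
    obtain ⟨x, rfl⟩ := mem_ran_shift_graph.1 hu
    have := h x (A x) ((LinearPMap.mem_graph_iff _).2 ⟨x, rfl, rfl⟩)
    rw [inner_sub_left, inner_smul_left, Complex.conj_conj, ← inner_smul_right]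
    exact this
  · rintro h a b hab
    obtain ⟨x, rfl, rfl⟩ := (LinearPMap.mem_graph_iff _).1 hab
    have := h _ (mem_ran_shift_graph.2 ⟨x, rfl⟩)
    rw [inner_sub_left, inner_smul_left, Complex.conj_conj, ← inner_smul_right] at this
    exact this

end Relations

/-! ### Ranges and deficiency vectors at every point -/

section Ranges

variable {H : Type*} [NormedAddCommGroup H] [InnerProductSpace ℂ H] {A : H →ₗ.[ℂ] H}

/-- The graph is complete, and regularity bounds its norm by that of (A - zI)x; a map bounded below
on a complete space has closed range. -/
theorem IsE1.isClosed_ran [CompleteSpace H] (hA : IsE1 A) (z : ℂ) :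
    IsClosed (ran (shift A.graph z) : Set H) := by
  obtain ⟨d, hd, hdA⟩ := hA.regular z
  have hcl : IsClosed (A.graph : Set (H × H)) := hA.closed
  have : CompleteSpace A.graph := hcl.completeSpace_coe
  let f : A.graph →L[ℂ] H :=
    (ContinuousLinearMap.snd ℂ H H - z • ContinuousLinearMap.fst ℂ H H).comp A.graph.subtypeL
  have hrange : (ran (shift A.graph z) : Set H) = Set.range f := by
    ext y
    rw [SetLike.mem_coe, mem_ran_shift]
    constructor
    · rintro ⟨x, hx⟩
      exact ⟨⟨_, hx⟩, by simp [f]⟩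
    · rintro ⟨⟨⟨a, b⟩, hab⟩, rfl⟩
      exact ⟨a, by simpa [f] using hab⟩
  rw [hrange]
  have hbound : ∀ p : A.graph, ‖p‖ ≤ ((1 + (1 + ‖z‖) / d).toNNReal : ℝ) * ‖f p‖ := by
    rintro ⟨⟨a, b⟩, hab⟩
    obtain ⟨x, hx, hb⟩ := (LinearPMap.mem_graph_iff _).1 hab
    simp only at hx hb
    have h1 : ‖a‖ ≤ ‖b - z • a‖ / d := by
      rw [le_div_iff₀ hd, mul_comm, ← hx, ← hb]
      exact hdA x
    have h2 : ‖b‖ ≤ ‖b - z • a‖ + ‖z‖ * ‖a‖ := by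
      rw [← norm_smul]; simpa using norm_add_le (b - z • a) (z • a)
    have h3 : f ⟨(a, b), hab⟩ = b - z • a := by simp [f]
    rw [h3, Real.coe_toNNReal _ (by positivity)]
    change ‖(a, b)‖ ≤ _
    have h4 : ‖z‖ * ‖a‖ ≤ ‖z‖ * (‖b - z • a‖ / d) := by gcongr
    have h5 : (1 + (1 + ‖z‖) / d) * ‖b - z • a‖ =
        ‖b - z • a‖ + ‖b - z • a‖ / d + ‖z‖ * (‖b - z • a‖ / d) := by ring
    have h6 : 0 ≤ ‖z‖ * (‖b - z • a‖ / d) := by positivity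
    have h7 : 0 ≤ ‖b - z • a‖ / d := by positivity
    rw [Prod.norm_mk, h5]
    exact max_le (by linarith [norm_nonneg (b - z • a)]) (by linarith)
  exact (f.antilipschitz_of_bound hbound).isClosed_range f.uniformContinuous

theorem IsE1.ran_orthogonal_orthogonal [CompleteSpace H] (hA : IsE1 A) (z : ℂ) :
    (ran (shift A.graph z))ᗮᗮ = ran (shift A.graph z) := by
  have : CompleteSpace (ran (shift A.graph z)) := (hA.isClosed_ran z).completeSpace_coe
  exact Submodule.orthogonal_orthogonal _

/-- Stability of the deficiency subspaces: nearby ranges meet a deficiency subspace trivially. -/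
theorem eq_zero_of_mem_ran_of_mem_orthogonal {z w : ℂ} {d : ℝ}
    (hd : ∀ x : A.domain, d * ‖(x : H)‖ ≤ ‖A x - w • (x : H)‖) (hzw : 2 * ‖z - w‖ < d) {n : H}
    (hn : n ∈ ran (shift A.graph z)) (hn' : n ∈ (ran (shift A.graph w))ᗮ) : n = 0 := by
  obtain ⟨x, rfl⟩ := mem_ran_shift_graph.1 hn
  have h0 := (Submodule.mem_orthogonal' _ _).1 hn' _ (mem_ran_shift_graph.2 ⟨x, rfl⟩)
  have hdx := hd x
  set n := A x - z • (x : H)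
  -- Orthogonality of n to n + (z - w)x gives ‖n‖ ≤ |z - w|‖x‖; then d‖x‖ ≤ 2|z - w|‖x‖, whence the
  -- factor 2 in the hypothesis.
  have hw : A x - w • (x : H) = n + (z - w) • (x : H) := by simp only [n, sub_smul]; abel
  rw [hw, inner_add_right, inner_self_eq_norm_sq_to_K] at h0
  have h1 : ‖n‖ ^ 2 ≤ ‖n‖ * (‖z - w‖ * ‖(x : H)‖) := by
    have h2 : ((‖n‖ : ℂ)) ^ 2 = -inner ℂ n ((z - w) • (x : H)) := eq_neg_of_add_eq_zero_left h0
    have h3 := congrArg norm h2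
    rw [norm_neg, norm_pow, Complex.norm_real, norm_norm] at h3
    rw [h3, ← norm_smul]
    exact norm_inner_le_norm _ _
  rw [hw] at hdx
  have h2 : ‖n + (z - w) • (x : H)‖ ≤ ‖n‖ + ‖z - w‖ * ‖(x : H)‖ := by
    rw [← norm_smul]; exact norm_add_le _ _
  by_contra hne
  have hnpos : 0 < ‖n‖ := norm_pos_iff.2 hne
  have h3 : ‖n‖ ≤ ‖z - w‖ * ‖(x : H)‖ := by
    rw [pow_two] at h1
    exact le_of_mul_le_mul_left h1 hnpos
  have hx0 : 0 < ‖(x : H)‖ := by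
    rcases (norm_nonneg (x : H)).eq_or_lt with h | h
    · rw [← h, mul_zero] at h3; linarith
    · exact h
  nlinarith

/-- The deficiency index is prescribed only off the real axis. A nonreal z close to w transfers it:
projecting the deficiency space at w onto the line at z is injective. -/
theorem IsE1.exists_eq_smul [CompleteSpace H] (hA : IsE1 A) (w : ℂ) {a b : H}
    (ha : a ∈ (ran (shift A.graph w))ᗮ) (hb : b ∈ (ran (shift A.graph w))ᗮ) (ha0 : a ≠ 0) :
    ∃ c : ℂ, b = c • a := by
  obtain ⟨d, hd, hdA⟩ := hA.regular w
  obtain ⟨z, hz, hzw⟩ : ∃ z : ℂ, z.im ≠ 0 ∧ 2 * ‖z - w‖ < d := by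
    by_cases hw : w.im = 0
    · refine ⟨w + (d / 4 : ℝ) * Complex.I, ?_, ?_⟩
      · simp [hw, hd.ne']
      · rw [add_sub_cancel_left, norm_mul, Complex.norm_I, Complex.norm_real, Real.norm_eq_abs,
          abs_of_pos (by positivity)]
        linarith
    · exact ⟨w, hw, by simpa using hd⟩
  have hdef := hA.deficiency (conj z) (by simpa using hz)
  rw [ker_shift_adjoint, Complex.conj_conj] at hdef
  obtain ⟨⟨e, he⟩, -, hspan⟩ := finrank_eq_one_iff'.1 hdef
  have hmem : ∀ n, inner ℂ e n = 0 → n ∈ ran (shift A.graph z) := fun n hn => by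
    rw [← hA.ran_orthogonal_orthogonal z, Submodule.mem_orthogonal]
    intro u hu
    obtain ⟨c, hc⟩ := hspan ⟨u, hu⟩
    have : u = c • e := (congrArg Subtype.val hc).symm
    rw [this, inner_smul_left, hn, mul_zero]
  have hea : inner ℂ e a ≠ 0 := fun h =>
    ha0 (eq_zero_of_mem_ran_of_mem_orthogonal hdA hzw (hmem a h) ha)
  -- This combination of a and b is orthogonal to e, hence lies in the range at z, while remaining
  -- orthogonal to the range at w.
  have h0 := eq_zero_of_mem_ran_of_mem_orthogonal hdA hzw
    (hmem (inner ℂ e a • b - inner ℂ e b • a) (by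
      rw [inner_sub_right, inner_smul_right, inner_smul_right]; ring))
    (Submodule.sub_mem _ (Submodule.smul_mem _ _ hb) (Submodule.smul_mem _ _ ha))
  refine ⟨(inner ℂ e a)⁻¹ * inner ℂ e b, ?_⟩
  rw [mul_smul, ← sub_eq_zero.1 h0, smul_smul, inv_mul_cancel₀ hea, one_smul]

/-- The range of `A - z I` is the orthogonal complement of any deficiency vector. -/
theorem IsE1.mem_ran_iff [CompleteSpace H] (hA : IsE1 A) {z : ℂ} {e : H}
    (he : e ∈ (ran (shift A.graph z))ᗮ) (he0 : e ≠ 0) {x : H} :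
    x ∈ ran (shift A.graph z) ↔ inner ℂ e x = 0 := by
  constructor
  · intro hx
    exact (Submodule.mem_orthogonal' _ _).1 he x hx
  · intro hx
    rw [← hA.ran_orthogonal_orthogonal z, Submodule.mem_orthogonal]
    intro u hu
    obtain ⟨c, rfl⟩ := hA.exists_eq_smul z he hu he0
    rw [inner_smul_left, hx, mul_zero]

end Ranges

/-! ### Resolvents of selfadjoint relations and entireness of ξ -/

section Resolvent

variable {H : Type*} [NormedAddCommGroup H] [InnerProductSpace ℂ H] {B : Submodule ℂ (H × H)}
  {v z : ℂ}

theorem mem_iff_resolventOp (hv : v ∉ spec B) {x y : H} :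
    (x, y) ∈ B ↔ x = resolventOp B v (y - v • x) := by
  rw [← mem_iff_eq_resolventOp hv, sub_add_cancel]

theorem mem_resolventOp_iff (hv : v ∉ spec B) {x y : H} :
    (y, x + z • y) ∈ B ↔
      (1 - (z - v) • resolventOp B v) y = resolventOp B v x := by
  have : x + z • y - v • y = x + (z - v) • y := by rw [sub_smul]; abel
  rw [mem_iff_resolventOp hv, this, map_add, map_smul]
  simp [sub_eq_iff_eq_add]

theorem one_sub_smul_mul_one_add_smul (hv : v ∉ spec B) (hz : z ∉ spec B) :
    (1 - (z - v) • resolventOp B v) * (1 + (z - v) • resolventOp B z) = 1 := by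
  ext x
  have h := (mem_resolventOp_iff hv).1 ((mem_iff_eq_resolventOp hz).2 (rfl :
    resolventOp B z x = resolventOp B z x))
  simp only [mul_apply_eq_comp, add_apply,
    smul_apply, map_add, map_smul, h]
  simp

/-- With T = (B - vI)⁻¹ the resolvent equation at z reads (1 - (z - v)T)y = Tx, so spectral
questions about the relation become questions about one bounded operator. -/
theorem notMem_spec_iff (hv : v ∉ spec B) :
    z ∉ spec B ↔ IsUnit (1 - (z - v) • resolventOp B v) := by
  set u := 1 - (z - v) • resolventOp B v
  constructor
  · intro hz
    have hr : u * (1 + (z - v) • resolventOp B z) = 1 := one_sub_smul_mul_one_add_smul hv hz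
    have hinj : ∀ y, u y = 0 → y = 0 := fun y hy => by
      have h := (mem_resolventOp_iff (z := z) (x := 0) (y := y) hv).2 (by rw [map_zero]; exact hy)
      rw [mem_iff_eq_resolventOp hz, map_zero] at h
      exact h
    have hl : (1 + (z - v) • resolventOp B z) * u = 1 := by
      ext x
      refine sub_eq_zero.1 (hinj _ ?_)
      have := congrArg (fun T : H →L[ℂ] H => T (u x)) hr
      simp only [mul_apply_eq_comp, one_apply_eq_self] at this
      rw [map_sub, mul_apply_eq_comp, this, one_apply_eq_self, sub_self]
    exact ⟨⟨_, _, hr, hl⟩, rfl⟩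
  · rintro hu
    refine not_not.2 ⟨Ring.inverse u * resolventOp B v, isResolvent_iff.2 fun x y => ?_⟩
    rw [mem_resolventOp_iff hv, mul_apply_eq_comp]
    constructor
    · intro h
      rw [← h, ← mul_apply_eq_comp]
      change y = (Ring.inverse u * u) y
      rw [Ring.inverse_mul_cancel _ hu, one_apply_eq_self]
    · rintro rfl
      change (u * Ring.inverse u) (resolventOp B v x) = _
      rw [Ring.mul_inverse_cancel _ hu, one_apply_eq_self]

theorem cayley_eq_inverse (hv : v ∉ spec B) (hz : z ∉ spec B) (ψ : H) :
    cayley B v ψ z = Ring.inverse (1 - (z - v) • resolventOp B v) ψ := by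
  have hu := (notMem_spec_iff hv).1 hz
  have h := one_sub_smul_mul_one_add_smul hv hz
  have : Ring.inverse (1 - (z - v) • resolventOp B v) = 1 + (z - v) • resolventOp B z := by
    rw [← Ring.inverse_mul_cancel_left _ (1 + (z - v) • resolventOp B z) hu, h, mul_one]
  rw [this, cayley]
  simp

theorem isSelfAdjoint_resolventOp [CompleteSpace H] (hB : IsSelfadjointRel B) {v : ℝ}
    (hv : (v : ℂ) ∉ spec B) : IsSelfAdjoint (resolventOp B v) := by
  rw [ContinuousLinearMap.isSelfAdjoint_iff_isSymmetric]
  intro x y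
  have hx := (mem_iff_eq_resolventOp hv).2 (rfl : resolventOp B v x = resolventOp B v x)
  have hy := (mem_iff_eq_resolventOp hv).2 (rfl : resolventOp B v y = resolventOp B v y)
  have h := inner_eq_of_mem_adjoint hx (hB.le hy)
  simp only [inner_add_left, inner_add_right, inner_smul_left, inner_smul_right,
    Complex.conj_ofReal] at h
  simp only [ContinuousLinearMap.coe_coe]
  exact (add_right_cancel h).symm

theorem im_eq_zero_of_mem_spec [CompleteSpace H] (hB : IsSelfadjointRel B) {v : ℝ}
    (hv : (v : ℂ) ∉ spec B) (hz : z ∈ spec B) : z.im = 0 := by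
  by_contra him
  refine (notMem_spec_iff hv).2 ?_ hz
  have hT := isSelfAdjoint_resolventOp hB hv
  set T := resolventOp B (v : ℂ)
  have hζ : z - v ≠ 0 := fun h => him (by rw [sub_eq_zero.1 h]; simp)
  have h1 : (z - v)⁻¹ ∉ spectrum ℂ T := fun hmem => by
    have h2 := hT.im_eq_zero_of_mem_spectrum hmem
    rw [Complex.inv_im] at h2
    simp [him, hζ] at h2
  rw [spectrum.notMem_iff] at h1
  have h2 : 1 - (z - v) • T = (z - v) • (algebraMap ℂ (H →L[ℂ] H) (z - v)⁻¹ - T) := by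
    rw [smul_sub, Algebra.algebraMap_eq_smul_one, smul_smul, mul_inv_cancel₀ hζ, one_smul]
  rw [h2]
  exact (IsUnit.smul (Units.mk0 _ hζ) h1 : _)

/-- The inverse is a normal operator, so its norm is its spectral radius. Its spectrum is controlled
by the map w ↦ (w - v)/(w - z) = 1 + (z - v)/(w - z) on the spectrum of B. -/
theorem norm_inverse_le [CompleteSpace H] (hB : IsSelfadjointRel B) {v : ℝ}
    (hv : (v : ℂ) ∉ spec B) (hz : z ∉ spec B) {r : ℝ} (hr : 0 < r)
    (hdist : ∀ w ∈ spec B, r ≤ ‖z - w‖) :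
    ‖Ring.inverse (1 - (z - v) • resolventOp B v)‖ ≤ 1 + ‖z - v‖ / r := by
  have hT := isSelfAdjoint_resolventOp hB hv
  have hu := (notMem_spec_iff hv).1 hz
  have hunit : ∀ w : ℂ, IsUnit (1 - (w - v) • resolventOp B v) ↔ w ∉ spec B := fun w =>
    (notMem_spec_iff hv).symm
  set T := resolventOp B (v : ℂ)
  set U := Ring.inverse (1 - (z - v) • T)
  have hnormal : IsStarNormal U := by
    constructor
    rw [← Ring.inverse_star]
    have : Commute (star (1 - (z - v) • T)) (1 - (z - v) • T) := by
      rw [star_sub, star_one, star_smul, hT.star_eq]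
      exact ((Commute.one_left _).sub_left
        (((Commute.one_right T).sub_right ((Commute.refl T).smul_right _)).smul_left _))
    exact this.ringInverse_ringInverse
  have key : ∀ s ∈ spectrum ℂ U, ‖s‖ ≤ 1 + ‖z - v‖ / r := by
    intro s hs
    by_contra! hlt
    refine hs ?_
    have h0 : 0 ≤ ‖z - v‖ / r := by positivity
    have hs1 : s - 1 ≠ 0 := fun h => by
      rw [sub_eq_zero.1 h, norm_one] at hlt
      linarith
    have hsn : ‖z - v‖ / r < ‖s - 1‖ := by
      have := norm_sub_norm_le s 1
      rw [norm_one] at this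
      linarith
    -- This w solves s = (w - v)/(w - z); a large |s - 1| puts it within distance r of z, hence off
    -- the spectrum.
    set w : ℂ := v + s * (z - v) / (s - 1)
    have hw : IsUnit (1 - (w - v) • T) := (hunit w).2 fun hmem => by
      have h1 := hdist w hmem
      have h2 : z - w = -((z - v) / (s - 1)) := by simp only [w]; field_simp; ring
      rw [h2, norm_neg, norm_div, le_div_iff₀ (norm_pos_iff.2 hs1)] at h1
      rw [div_lt_iff₀ hr] at hsn
      linarith
    have hfac : algebraMap ℂ (H →L[ℂ] H) s - U = (s - 1) • (U * (1 - (w - v) • T)) := by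
      have h1 : (w - v) = s * (z - v) / (s - 1) := by simp [w]
      have h2 : U - (z - v) • (U * T) = 1 := by
        rw [← Ring.inverse_mul_cancel _ hu, mul_sub, mul_one, mul_smul_comm]
      rw [h1, mul_sub, mul_one, smul_sub, mul_smul_comm, smul_smul, mul_div_cancel₀ _ hs1,
        mul_smul, Algebra.algebraMap_eq_smul_one, ← h2, smul_sub s, sub_smul s 1 U, one_smul]
      abel
    rw [spectrum.mem_resolventSet_iff, hfac]
    exact (IsUnit.smul (Units.mk0 _ hs1) (hu.ringInverse.mul hw) : _)
  have hsr := IsStarNormal.spectralRadius_eq_nnnorm U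
  have hle : spectralRadius ℂ U ≤ ((1 + ‖z - v‖ / r).toNNReal : ENNReal) := by
    refine iSup₂_le fun s hs => ?_
    rw [ENNReal.coe_le_coe, ← NNReal.coe_le_coe, Real.coe_toNNReal _ (by positivity)]
    exact key s hs
  rw [hsr, ENNReal.coe_le_coe, ← NNReal.coe_le_coe, Real.coe_toNNReal _ (by positivity)] at hle
  exact hle

theorem norm_cayley_le [CompleteSpace H] (hB : IsSelfadjointRel B) {v : ℝ}
    (hv : (v : ℂ) ∉ spec B) (hz : z ∉ spec B) {r : ℝ} (hr : 0 < r)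
    (hdist : ∀ w ∈ spec B, r ≤ ‖z - w‖) (ψ : H) :
    ‖cayley B v ψ z‖ ≤ (1 + ‖z - v‖ / r) * ‖ψ‖ := by
  rw [cayley_eq_inverse hv hz]
  exact ContinuousLinearMap.le_of_opNorm_le _ (norm_inverse_le hB hv hz hr hdist) ψ

theorem isOpen_compl_spec {h : ℂ → ℂ} (hh : IsRealEntireWithZeros B h) : IsOpen (spec B)ᶜ := by
  have : (spec B)ᶜ = {z | h z ≠ 0} := by
    ext z
    simp [← hh.zeros z]
  rw [this]
  exact isOpen_ne_fun hh.entire.continuous continuous_const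

theorem differentiableAt_cayley [CompleteSpace H] {h : ℂ → ℂ} (hh : IsRealEntireWithZeros B h)
    (hv : v ∉ spec B) (hz : z ∉ spec B) (ψ : H) : DifferentiableAt ℂ (cayley B v ψ) z := by
  have hd : DifferentiableAt ℂ (fun w => Ring.inverse (1 - (w - v) • resolventOp B v) ψ) z := by
    have h1 : DifferentiableAt ℂ (fun w : ℂ => 1 - (w - v) • resolventOp B v) z := by fun_prop
    have h2 := (differentiableAt_inverse (𝕜 := ℂ) ((notMem_spec_iff hv).1 hz)).comp z h1
    exact h2.clm_apply (differentiableAt_const ψ)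
  refine hd.congr_of_eventuallyEq ?_
  filter_upwards [(isOpen_compl_spec hh).mem_nhds hz] with w hw
  exact cayley_eq_inverse hv hw ψ

theorem xi_of_notMem {h : ℂ → ℂ} (hz : z ∉ spec B) (ψ : H) :
    xi B h v ψ z = h z • cayley B v ψ z := if_neg hz

/-- Since h(v) ≠ 0, h is not identically zero and its zeros are isolated. -/
theorem eventually_ne_spec {h : ℂ → ℂ} (hh : IsRealEntireWithZeros B h) (hv : v ∉ spec B)
    (z : ℂ) : ∀ᶠ w in 𝓝[≠] z, w ∉ spec B := by
  have han : AnalyticOnNhd ℂ h Set.univ := fun w _ => hh.entire.analyticAt w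
  rcases (han z trivial).eventually_eq_zero_or_eventually_ne_zero with h0 | h0
  · have := han.eqOn_zero_of_preconnected_of_eventuallyEq_zero isPreconnected_univ trivial h0
    exact absurd ((hh.zeros v).1 (this trivial)) hv
  · filter_upwards [h0] with w hw
    rwa [← hh.zeros w]

/-- The function `ξ` is entire. -/
theorem differentiable_xi [CompleteSpace H] (hB : IsSelfadjointRel B) {v : ℝ}
    (hv : (v : ℂ) ∉ spec B) {h : ℂ → ℂ} (hh : IsRealEntireWithZeros B h) (ψ : H) :
    Differentiable ℂ (xi B h v ψ) := by
  set f : ℂ → H := fun w => h w • cayley B v ψ w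
  have hf : ∀ w, w ∉ spec B → DifferentiableAt ℂ f w := fun w hw =>
    (hh.entire w).smul (differentiableAt_cayley hh hv hw ψ)
  intro z
  by_cases hz : z ∈ spec B
  · obtain ⟨ρ, hρ, hball⟩ := Metric.mem_nhdsWithin_iff.1 (eventually_ne_spec hh hv z)
    -- Halving the radius makes z the nearest spectral point to each w in the ball.
    set s := Metric.ball z (ρ / 2)
    have hs : s ∈ 𝓝 z := Metric.ball_mem_nhds z (by positivity)
    have hns : ∀ w ∈ s \ {z}, w ∉ spec B := fun w hw =>
      hball ⟨Metric.ball_subset_ball (by linarith) hw.1, hw.2⟩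
    have hiso : ∀ w ∈ s \ {z}, ∀ w' ∈ spec B, ‖w - z‖ ≤ ‖w - w'‖ := by
      intro w hw w' hw'
      by_cases hz' : w' = z
      · rw [hz']
      · have h1 : ρ ≤ dist w' z := not_lt.1 fun hlt => hball ⟨hlt, hz'⟩ hw'
        have h2 : dist w z < ρ / 2 := hw.1
        rw [← dist_eq_norm, ← dist_eq_norm]
        have := dist_triangle_left w' z w
        linarith
    obtain ⟨M, hM⟩ := (isCompact_closedBall z (ρ / 2)).exists_bound_of_continuousOn
      (f := dslope h z) (((Complex.differentiableOn_dslope (s := Set.univ) univ_mem).2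
        hh.entire.differentiableOn).continuousOn.mono (Set.subset_univ _))
    have hh0 : h z = 0 := (hh.zeros z).2 hz
    -- The zero of h at z gives |h(w)| ≤ M|w - z|, which offsets the 1/|w - z| growth of `cayley`;
    -- the singularity is removable.
    have hdiff := Complex.differentiableOn_update_limUnder_of_bddAbove hs
      (fun w hw => (hf w (hns w hw)).differentiableWithinAt)
      ⟨M * (ρ + (ρ + ‖z - v‖)) * ‖ψ‖, by
        rintro _ ⟨w, hw, rfl⟩
        have hwz : w ≠ z := hw.2
        have hpos : 0 < ‖w - z‖ := norm_pos_iff.2 (sub_ne_zero.2 hwz)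
        have hlt : ‖w - z‖ < ρ / 2 := by rw [← dist_eq_norm]; exact hw.1
        have h1 : ‖h w‖ ≤ M * ‖w - z‖ := by
          have h2 := sub_smul_dslope h z w
          rw [hh0, sub_zero, smul_eq_mul] at h2
          rw [← h2, norm_mul, mul_comm]
          gcongr
          exact hM w (Metric.ball_subset_closedBall hw.1)
        have hM0 : 0 ≤ M := by
          by_contra! hneg
          have := norm_nonneg (h w)
          nlinarith
        have h3 := norm_cayley_le hB hv (hns w hw) hpos (hiso w hw) ψ
        have h4 : ‖w - v‖ ≤ ρ + ‖z - v‖ := by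
          have := norm_add_le (w - z) (z - v)
          rw [sub_add_sub_cancel] at this
          linarith
        calc ‖f w‖ = ‖h w‖ * ‖cayley B v ψ w‖ := norm_smul _ _
          _ ≤ (M * ‖w - z‖) * ((1 + ‖w - v‖ / ‖w - z‖) * ‖ψ‖) := by gcongr
          _ = M * (‖w - z‖ + ‖w - v‖) * ‖ψ‖ := by field_simp
          _ ≤ M * (ρ + (ρ + ‖z - v‖)) * ‖ψ‖ := by
            gcongr
            linarith⟩
    refine (hdiff.differentiableAt hs).congr_of_eventuallyEq ?_
    filter_upwards [hs] with w hw
    by_cases hwz : w = z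
    · rw [hwz, Function.update_self]
      exact if_pos hz
    · rw [Function.update_of_ne hwz]
      exact xi_of_notMem (hns w ⟨hw, hwz⟩) ψ
  · refine (hf z hz).congr_of_eventuallyEq ?_
    filter_upwards [(isOpen_compl_spec hh).mem_nhds hz] with w hw
    exact xi_of_notMem hw ψ

end Resolvent

/-! ### Deficiency vectors, gauges and the functional model -/

section Model

variable {H : Type*} [NormedAddCommGroup H] [InnerProductSpace ℂ H] {A : H →ₗ.[ℂ] H}
  {B : Submodule ℂ (H × H)} {v z : ℂ} {ψ : H}

theorem IsSelfadjointExtension.le_adjoint (hB : IsSelfadjointExtension A B) :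
    B ≤ A.graph.adjoint := by
  intro p hp
  rw [Submodule.mem_adjoint_iff]
  intro a b hab
  exact sub_eq_zero.2 (inner_eq_of_mem_adjoint (hB.2 hab) (hB.1.le hp))

theorem cayley_mem_ker (hB : IsSelfadjointExtension A B) (hz : z ∉ spec B)
    (hψ : ψ ∈ ker (shift A.graph.adjoint v)) :
    cayley B v ψ z ∈ ker (shift A.graph.adjoint z) := by
  rw [mem_ker_shift] at hψ ⊢
  have h1 := hB.le_adjoint ((mem_iff_eq_resolventOp hz).2
    (rfl : resolventOp B z ψ = resolventOp B z ψ))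
  convert A.graph.adjoint.add_mem hψ (A.graph.adjoint.smul_mem (z - v) h1) using 1
  rw [Prod.smul_mk, Prod.mk_add_mk, cayley, Prod.mk.injEq]
  refine ⟨rfl, ?_⟩
  module

theorem dense_compl_spec {h : ℂ → ℂ} (hh : IsRealEntireWithZeros B h) (hv : v ∉ spec B) :
    Dense (spec B)ᶜ := fun z =>
  mem_closure_iff_frequently.2
    ((eventually_ne_spec hh hv z).frequently.filter_mono nhdsWithin_le_nhds)

/-- Off the spectrum this is `cayley_mem_ker`; at spectral points the defining identities persist by
continuity, the complement of the spectrum being dense. -/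
theorem xi_mem_ker [CompleteSpace H] (hB : IsSelfadjointExtension A B) {v : ℝ}
    (hv : (v : ℂ) ∉ spec B) (hψ : ψ ∈ ker (shift A.graph.adjoint (v : ℂ))) {h : ℂ → ℂ}
    (hh : IsRealEntireWithZeros B h) (z : ℂ) :
    xi B h v ψ z ∈ ker (shift A.graph.adjoint z) := by
  rw [mem_ker_shift, Submodule.mem_adjoint_iff]
  intro a b hab
  have hc := (differentiable_xi hB.1 hv hh ψ).continuous
  refine congrFun (Continuous.ext_on (f := fun z => inner ℂ b (xi B h v ψ z) -
    inner ℂ a (z • xi B h v ψ z)) (g := fun _ => 0) (dense_compl_spec hh hv) (by fun_prop)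
    continuous_const fun w hw => ?_) z
  have := Submodule.smul_mem _ (h w) (cayley_mem_ker hB hw hψ)
  rw [← xi_of_notMem hw, mem_ker_shift, Submodule.mem_adjoint_iff] at this
  exact this a b hab

theorem map_cayley {J : H →ₗ⋆[ℂ] H} (hJB : Commutes J B) {v : ℝ} (hJψ : J ψ = ψ)
    (hz : z.im ≠ 0) : J (cayley B v ψ z) = cayley B v ψ (conj z) := by
  rw [cayley, cayley, map_add, map_smulₛₗ, hJB z hz, hJψ, map_sub, Complex.conj_ofReal]

theorem notMem_spec_of_im_ne_zero [CompleteSpace H] (hB : IsSelfadjointRel B) {v : ℝ}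
    (hv : (v : ℂ) ∉ spec B) (hz : z.im ≠ 0) : z ∉ spec B :=
  fun h => hz (im_eq_zero_of_mem_spec hB hv h)

theorem map_xi [CompleteSpace H] (hB : IsSelfadjointRel B) {v : ℝ}
    (hv : (v : ℂ) ∉ spec B) {h : ℂ → ℂ} (hh : IsRealEntireWithZeros B h)
    {J : H →ₗ⋆[ℂ] H} (hJB : Commutes J B) (hJψ : J ψ = ψ) (hz : z.im ≠ 0) :
    J (xi B h v ψ z) = xi B h v ψ (conj z) := by
  rw [xi_of_notMem (notMem_spec_of_im_ne_zero hB hv hz),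
    xi_of_notMem (notMem_spec_of_im_ne_zero hB hv (by simpa using hz)), map_smulₛₗ,
    map_cayley hJB hJψ hz, hh.real]

/-- Matrix coefficients of `cayley` have moderate growth at the real axis and at infinity. -/
theorem norm_inner_cayley_le [CompleteSpace H] (hB : IsSelfadjointRel B) {v : ℝ}
    (hv : (v : ℂ) ∉ spec B) (η ψ : H) (hz : 0 < z.im) :
    ‖inner ℂ η (cayley B v ψ z)‖ ≤ (2 + |v|) * (‖η‖ * ‖ψ‖) * (1 + ‖z‖) / z.im := by
  have h1 := norm_cayley_le hB hv (notMem_spec_of_im_ne_zero hB hv hz.ne') hz (fun w hw => by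
    have := Complex.im_le_norm (z - w)
    rwa [Complex.sub_im, im_eq_zero_of_mem_spec hB hv hw, sub_zero] at this) ψ
  have h2 : ‖z - v‖ ≤ ‖z‖ + |v| := by simpa using norm_sub_le z (v : ℂ)
  have h3 : z.im ≤ ‖z‖ := Complex.im_le_norm z
  have h4 : 1 + ‖z - v‖ / z.im ≤ (2 + |v|) * (1 + ‖z‖) / z.im := by
    rw [one_add_div hz.ne']
    gcongr
    nlinarith [abs_nonneg v, norm_nonneg z, mul_nonneg (abs_nonneg v) (norm_nonneg z)]
  calc _ ≤ ‖η‖ * ‖cayley B v ψ z‖ := norm_inner_le_norm _ _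
    _ ≤ ‖η‖ * (((2 + |v|) * (1 + ‖z‖) / z.im) * ‖ψ‖) := by
      refine mul_le_mul_of_nonneg_left (h1.trans ?_) (norm_nonneg _)
      gcongr
    _ = _ := by ring

/-- Simplicity: the deficiency vectors at nonreal points are total. -/
theorem IsE1.eq_zero_of_inner_eq_zero [CompleteSpace H] (hA : IsE1 A) {ξ : ℂ → H}
    (hξ : ∀ z, ξ z ∈ ker (shift A.graph.adjoint z)) (hξ0 : ∀ z, ξ z ≠ 0) {x : H}
    (hx : ∀ z : ℂ, z.im ≠ 0 → inner ℂ (ξ (conj z)) x = 0) : x = 0 := by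
  have : x ∈ (⊥ : Submodule ℂ H) := by
    rw [← hA.simple]
    simp only [Submodule.mem_iInf]
    intro z hz
    refine (hA.mem_ran_iff ?_ (hξ0 (conj z))).2 (hx z hz)
    have := hξ (conj z)
    rwa [ker_shift_adjoint, Complex.conj_conj] at this
  exact (Submodule.mem_bot ℂ).1 this

/-- The gauges of `A` in terms of deficiency vectors. -/
theorem IsE1.isEntireGauge_iff [CompleteSpace H] (hA : IsE1 A) {ξ : ℂ → H}
    (hξ : ∀ z, ξ z ∈ ker (shift A.graph.adjoint z)) (hξ0 : ∀ z, ξ z ≠ 0) {μ : H} :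
    IsEntireGauge A μ ↔ ∀ z, inner ℂ (ξ (conj z)) μ ≠ 0 := by
  have hξ' : ∀ z, ξ (conj z) ∈ (ran (shift A.graph z))ᗮ := fun z => by
    have := hξ (conj z)
    rwa [ker_shift_adjoint, Complex.conj_conj] at this
  have hran : ∀ z x, x ∈ ran (shift A.graph z) ↔ inner ℂ (ξ (conj z)) x = 0 := fun z x =>
    hA.mem_ran_iff (hξ' z) (hξ0 _)
  constructor
  · intro hμ z h0
    have htop := (hμ z).codisjoint.eq_top
    have hle : Submodule.span ℂ {μ} ≤ ran (shift A.graph z) := by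
      rw [Submodule.span_singleton_le_iff_mem, hran]; exact h0
    rw [sup_eq_left.2 hle] at htop
    -- If μ lay in the range, the range would be everything and ξ(z̄) would be orthogonal to itself.
    have hmem : ξ (conj z) ∈ ran (shift A.graph z) := htop ▸ Submodule.mem_top
    exact hξ0 _ (inner_self_eq_zero.1 ((hran _ _).1 hmem))
  · intro hμ z
    constructor
    · rw [Submodule.disjoint_def]
      intro x hx hx'
      obtain ⟨c, rfl⟩ := Submodule.mem_span_singleton.1 hx'
      rw [hran, inner_smul_right] at hx
      rw [(mul_eq_zero.1 hx).resolve_right (hμ z), zero_smul]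
    · rw [codisjoint_iff, Submodule.eq_top_iff']
      intro x
      refine Submodule.mem_sup.2 ⟨x - (inner ℂ (ξ (conj z)) x / inner ℂ (ξ (conj z)) μ) • μ, ?_,
        _, Submodule.smul_mem _ _ (Submodule.mem_span_singleton_self μ), sub_add_cancel _ _⟩
      rw [hran, inner_sub_right, inner_smul_right, div_mul_cancel₀ _ (hμ z), sub_self]

/-- Two real entire gauges, one of which is represented by the constant function `1`, are
proportional. -/
theorem IsE1.exists_real_smul_of_isEntireGauge [CompleteSpace H] (hA : IsE1 A)
    (hB : IsSelfadjointExtension A B) {J : H →ₗ⋆[ℂ] H} (hJ : IsInvolution J)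
    (hJB : Commutes J B) {v : ℝ} (hv : (v : ℂ) ∉ spec B) (hψ_ne : ψ ≠ 0)
    (hψ : ψ ∈ ker (shift A.graph.adjoint (v : ℂ))) (hJψ : J ψ = ψ) {h : ℂ → ℂ}
    (hh : IsRealEntireWithZeros B h) {μ μ' : H}
    (hone : ∀ z, inner ℂ (xi B h v ψ (conj z)) μ = 1) (hμ' : IsEntireGauge A μ')
    (hJμ' : J μ' = μ') : ∃ c : ℝ, c ≠ 0 ∧ μ' = (c : ℂ) • μ := by
  set ξ := xi B h v ψ
  have hξ : ∀ z, ξ z ∈ ker (shift A.graph.adjoint z) := xi_mem_ker hB hv hψ hh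
  have hξ0 : ∀ z, ξ z ≠ 0 := fun z h0 => by
    have := hone (conj z)
    rw [Complex.conj_conj, h0, inner_zero_left] at this
    exact zero_ne_one this
  have hone' : ∀ z, inner ℂ μ (ξ z) = 1 := fun z => by
    have := hone (conj z)
    rw [Complex.conj_conj] at this
    rw [← inner_conj_symm, this, map_one]
  set F : ℂ → ℂ := fun z => inner ℂ μ' (ξ z)
  have hFconj : ∀ z, conj (F (conj z)) = inner ℂ (ξ (conj z)) μ' := fun z => inner_conj_symm _ _
  have hF0 : ∀ z, F z ≠ 0 := fun z h0 => by
    refine (hA.isEntireGauge_iff hξ hξ0).1 hμ' (conj z) ?_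
    rw [← hFconj, Complex.conj_conj, h0, map_zero]
  have hFreal : ∀ z : ℂ, z.im ≠ 0 → F (conj z) = conj (F z) := fun z hz => by
    have h1 := hJ.inner_map (ξ z) μ'
    rw [hJμ', map_xi hB.1 hv hh hJB hJψ hz] at h1
    change _ = F z at h1
    rw [← h1, inner_conj_symm]
  have hF : Differentiable ℂ F := fun z =>
    ((innerSL ℂ μ').differentiableAt).comp z (differentiable_xi hB.1 hv hh ψ z)
  have hns : ∀ z : ℂ, 0 < z.im → z ∉ spec B := fun z hz =>
    notMem_spec_of_im_ne_zero hB.1 hv hz.ne'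
  have hsplit : ∀ (η : H) (z : ℂ), 0 < z.im → inner ℂ η (ξ z) = h z * inner ℂ η (cayley B v ψ z) :=
    fun η z hz => by
      simp only [ξ]
      rw [xi_of_notMem (hns z hz), inner_smul_right]
  have hhb : ∀ z : ℂ, 0 < z.im → h z * inner ℂ μ (cayley B v ψ z) = 1 := fun z hz => by
    rw [← hsplit μ z hz, hone']
  have hμ0 : μ ≠ 0 := fun h0 => by
    have := hone' 0
    rw [h0, inner_zero_left] at this
    exact zero_ne_one this
  have hψp : 0 < ‖ψ‖ := norm_pos_iff.2 hψ_ne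
  have hμp : 0 < ‖μ‖ := norm_pos_iff.2 hμ0
  -- Here b = 1/h on the upper half-plane, hence zero-free, and a = F·b. The constant C is enlarged
  -- to serve both μ and μ'.
  have hconst := const_of_quotient_moderate_growth (F := F)
    (a := fun z => inner ℂ μ' (cayley B v ψ z)) (b := fun z => inner ℂ μ (cayley B v ψ z))
    (C := (2 + |v|) * ((‖μ'‖ + ‖μ‖) * ‖ψ‖)) hF hF0 (fun z hz => hFreal z hz.ne')
    (fun z hz => (((innerSL ℂ μ).differentiableAt).comp z
      (differentiableAt_cayley hh hv (hns z hz) ψ)).differentiableWithinAt)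
    (fun z hz => right_ne_zero_of_mul_eq_one (hhb z hz))
    (fun z hz => by
      have h1 := hhb z hz
      simp only [F]
      rw [hsplit μ' z hz]
      linear_combination -(inner ℂ μ' (cayley B v ψ z)) * h1)
    (by positivity)
    (fun z hz => (norm_inner_cayley_le hB.1 hv μ' ψ hz).trans (by
      gcongr
      linarith [norm_nonneg μ]))
    (fun z hz => (norm_inner_cayley_le hB.1 hv μ ψ hz).trans (by
      gcongr
      linarith [norm_nonneg μ']))
  have hFim : conj (F 0) = F 0 := by
    have := hFreal Complex.I (by simp)
    rw [hconst, hconst Complex.I] at this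
    exact this.symm
  obtain ⟨c, hc⟩ := Complex.conj_eq_iff_real.1 hFim
  refine ⟨c, fun h0 => hF0 0 (by rw [hc, h0, Complex.ofReal_zero]), ?_⟩
  refine sub_eq_zero.1 (hA.eq_zero_of_inner_eq_zero hξ hξ0 fun z _ => ?_)
  rw [inner_sub_right, inner_smul_right, hone z, ← hFconj, hconst, hFim, hc]
  ring

end Model

end EntireOperator

/-! ### The main theorem -/

open EntireOperator

theorem mainTheorem5 {H : Type*} [NormedAddCommGroup H] [InnerProductSpace ℂ H] [CompleteSpace H]
    [TopologicalSpace.SeparableSpace H]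
    (A : H →ₗ.[ℂ] H) (hA : EntireOperator.IsE1 A)
    (Aγ : Submodule ℂ (H × H)) (hAγ : EntireOperator.IsSelfadjointExtension A Aγ)
    (J : H →ₗ⋆[ℂ] H) (hJ : EntireOperator.IsInvolution J) (hJA : EntireOperator.Commutes J Aγ)
    (v : ℝ) (hv : (v : ℂ) ∉ EntireOperator.spec Aγ)
    (ψ : H) (hψ_ne : ψ ≠ 0)
    (hψ : ψ ∈ EntireOperator.ker (EntireOperator.shift A.graph.adjoint (v : ℂ)))
    (hJψ : J ψ = ψ)
    (h : ℂ → ℂ) (hh : EntireOperator.IsRealEntireWithZeros Aγ h)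
    (h_one : (fun _ => 1 : ℂ → ℂ) ∈
      EntireOperator.modelSpace (EntireOperator.xi Aγ h (v : ℂ) ψ)) :
    ∃ μ : H,
      J μ = μ ∧
      (∀ z : ℂ, z ∉ EntireOperator.spec Aγ →
        h z = (inner ℂ μ (ψ + (z - (v : ℂ)) • EntireOperator.resolventOp Aγ z ψ))⁻¹) ∧
      (∀ μ' : H, (EntireOperator.IsEntireGauge A μ' ∧ J μ' = μ') ↔
        ∃ c : ℝ, c ≠ 0 ∧ μ' = (c : ℂ) • μ) ∧
      (∀ (φ : H) (z : ℂ),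
        φ - EntireOperator.Phi (EntireOperator.xi Aγ h (v : ℂ) ψ) φ z • μ ∈
          EntireOperator.ran (EntireOperator.shift A.graph z)) := by
  obtain ⟨μ, hμ⟩ := h_one
  have hone : ∀ z, inner ℂ (xi Aγ h v ψ (conj z)) μ = 1 := fun z => congrFun hμ z
  have hξ : ∀ z, xi Aγ h v ψ z ∈ ker (shift A.graph.adjoint z) := xi_mem_ker hAγ hv hψ hh
  have hξ0 : ∀ z, xi Aγ h v ψ z ≠ 0 := fun z h0 => by
    have := hone (conj z)
    rw [Complex.conj_conj, h0, inner_zero_left] at this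
    exact zero_ne_one this
  have hJμ : J μ = μ := by
    refine sub_eq_zero.1 (hA.eq_zero_of_inner_eq_zero hξ hξ0 fun z hz => ?_)
    -- Since ξ(z̄) = Jξ(z), this pairing equals ⟨μ, ξ(z)⟩, so Jμ is also represented by 1 at nonreal
    -- points and totality applies.
    have h1 : inner ℂ (xi Aγ h v ψ (conj z)) (J μ) = 1 := by
      have h2 := hone (conj z)
      rw [Complex.conj_conj] at h2
      rw [← map_xi hAγ.1 hv hh hJA hJψ hz, hJ.inner_map, ← inner_conj_symm, h2, map_one]
    rw [inner_sub_right, h1, hone, sub_self]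
  refine ⟨μ, hJμ, fun z hz => ?_, fun μ' => ⟨?_, ?_⟩, fun φ z => ?_⟩
  · have h1 := hone (conj z)
    rw [Complex.conj_conj, xi_of_notMem hz] at h1
    have h2 := congrArg conj h1
    rw [inner_conj_symm, map_one, inner_smul_right] at h2
    exact eq_inv_of_mul_eq_one_left h2
  · rintro ⟨hμ', hJμ'⟩
    exact hA.exists_real_smul_of_isEntireGauge hAγ hJ hJA hv hψ_ne hψ hJψ hh hone hμ' hJμ'
  · rintro ⟨c, hc, rfl⟩
    refine ⟨(hA.isEntireGauge_iff hξ hξ0).2 fun z => ?_, ?_⟩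
    · rw [inner_smul_right, hone, mul_one]
      exact Complex.ofReal_ne_zero.2 hc
    · rw [map_smulₛₗ, hJμ, Complex.conj_ofReal]
  · have he := hξ (conj z)
    rw [ker_shift_adjoint, Complex.conj_conj] at he
    rw [hA.mem_ran_iff he (hξ0 _), inner_sub_right, inner_smul_right, hone, mul_one]
    exact sub_self _
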